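/- A set $S$ of positive integers is \emph{robust} if for each positive integer $j$ there is an integer $m\ge 2$ such that $n\in S$ for all integers $n$ with $m\le n\le m^j$. For a class $\mathcal C$ of languages over $\{0,1\}$, let $\mathrm{r.o.}\mathcal C$ be the class of all languages $L\subseteq\{0,1\}^*$ for which there are a robust set $S$ and a language $L'\in\mathcal C$ such that $L\cap\{0,1\}^n=L'\cap\{0,1\}^n$ for every $n\in S$. Let $\mathrm{SIZE}(s(n))$ be the class of languages decided by a family of Boolean circuits, one circuit for each input length $n$, of size $O(s(n))$. Let $\Sigma^p_2$ be the second level of the polynomial hierarchy: $L\in\Sigma^p_2$ if and only if there are a polynomial-time decidable predicate $V$ and a polynomial $p$ such that, for all $x\in\{0,1\}^*$, $x\in L$ if and only if there is a string $y$ with $|y|\le p(|x|)$ such that $V(x,y,z)$ holds for all strings $z$ with $|z|\le p(|x|)$. \textbf{Theorem.} For each integer $k>1$, $\Sigma^p_2\not\subseteq \mathrm{r.o.}\,\mathrm{SIZE}(n^k)$; that is, there is a language in $\Sigma^p_2$ that is not in $\mathrm{r.o.}\,\mathrm{SIZE}(n^k)$. -/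

import Mathlib

/-! ### Boolean circuits -/

/-- A gate of fan-in at most two over the standard basis; its inputs are chosen among `m`
available wires. -/
inductive CircuitGate (m : ℕ) : Type where
  | const (b : Bool) : CircuitGate m
  | not (i : Fin m) : CircuitGate m
  | and (i j : Fin m) : CircuitGate m
  | or (i j : Fin m) : CircuitGate m

/-- The output bit of a gate, given the values carried by the available wires. -/
def CircuitGate.eval {m : ℕ} (v : Fin m → Bool) : CircuitGate m → Bool
  | .const b => b
  | .not i => !(v i)
  | .and i j => v i && v j
  | .or i j => v i || v j

/-- `GateList n s`: `s` gates in topological order on `n` input wires. The wires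
`0, …, n - 1` are the input bits and the wire `n + j` carries the output of gate `j`; each gate
reads input bits and outputs of earlier gates. -/
inductive GateList (n : ℕ) : ℕ → Type where
  | nil : GateList n 0
  | snoc {s : ℕ} (c : GateList n s) (g : CircuitGate (n + s)) : GateList n (s + 1)

/-- The values of all `n + s` wires on the input `x`. -/
def GateList.wires {n : ℕ} (x : Fin n → Bool) : {s : ℕ} → GateList n s → (Fin (n + s) → Bool)
  | _, .nil => x
  | _, .snoc c g =>
      Fin.snoc (α := fun _ => Bool) (c.wires x) (g.eval (c.wires x))

/-- A Boolean circuit with `n` inputs and one output; its size is its number of gates. -/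
structure BoolCircuit (n : ℕ) : Type where
  size : ℕ
  gates : GateList n size
  out : Fin (n + size)

/-- The Boolean function computed by a circuit. -/
def BoolCircuit.eval {n : ℕ} (C : BoolCircuit n) (x : Fin n → Bool) : Bool :=
  C.gates.wires x C.out

/-- `SIZE s`: the languages decided by a family of Boolean circuits, one for each input length
`n`, of size `O(s n)`. -/
def SIZE (s : ℕ → ℕ) : Set (Language Bool) :=
  {L | ∃ C : ∀ n : ℕ, BoolCircuit n,
    (∀ (n : ℕ) (x : Fin n → Bool), (C n).eval x = true ↔ List.ofFn x ∈ L) ∧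
    (fun n => ((C n).size : ℝ)) =O[Filter.atTop] (fun n => (s n : ℝ))}

/-! ### The class `Σ₂ᵖ` -/

/-- The encoding of a triple of binary strings as one string over the alphabet `{0, 1, #}`,
namely `x # y # z`, where `none` plays the role of the separator `#`. -/
def encodeTriple (t : List Bool × List Bool × List Bool) : List (Option Bool) :=
  t.1.map some ++ none :: (t.2.1.map some ++ none :: t.2.2.map some)

/-- A ternary predicate on binary strings that a Turing machine decides in time polynomial in the
length of its input triple. -/
def PolyTimeDecidable (V : List Bool → List Bool → List Bool → Bool) : Prop :=
  Nonempty (Turing.TM2ComputableInPolyTime encodeTriple Computability.encodeBool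
    (fun t : List Bool × List Bool × List Bool => V t.1 t.2.1 t.2.2))

/-- The second level `Σ₂ᵖ` of the polynomial hierarchy: `L` is in it if, for a polynomial-time
decidable `V` and a polynomial `p`, `x ∈ L` iff there is `y` of length at most `p(|x|)` such that
for all `z` of length at most `p(|x|)` the predicate `V(x, y, z)` holds. -/
def SigmaTwoP : Set (Language Bool) :=
  {L | ∃ (V : List Bool → List Bool → List Bool → Bool) (p : Polynomial ℕ),
    PolyTimeDecidable V ∧
    ∀ x : List Bool, x ∈ L ↔
      ∃ y : List Bool, y.length ≤ p.eval x.length ∧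
        ∀ z : List Bool, z.length ≤ p.eval x.length → V x y z = true}

/-! ### Robustly-often simulations -/

/-- A set of positive integers is robust if for each positive integer `k` there is `m ≥ 2` such
that the set contains all `n` with `m ≤ n ≤ m ^ k`. -/
def IsRobust (S : Set ℕ) : Prop :=
  (∀ n ∈ S, 0 < n) ∧
    ∀ k : ℕ, 0 < k → ∃ m : ℕ, 2 ≤ m ∧ ∀ n : ℕ, m ≤ n → n ≤ m ^ k → n ∈ S

/-- `L ∈ 𝒞` on `S`: some language in `𝒞` agrees with `L` on all strings whose length is
in `S`. -/
def InClassOn (𝒞 : Set (Language Bool)) (S : Set ℕ) (L : Language Bool) : Prop :=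
  ∃ L' ∈ 𝒞, ∀ n ∈ S, ∀ x : List Bool, x.length = n → (x ∈ L ↔ x ∈ L')

/-- The class of languages that have a robustly-often simulation in `𝒞`. -/
def RobustlyOften (𝒞 : Set (Language Bool)) : Set (Language Bool) :=
  {L | ∃ S : Set ℕ, IsRobust S ∧ InClassOn 𝒞 S L}

/-! Fix `K = k + 2`. At length `n` put `q = n ^ K` and `t = n ^ (3 * K)`. By counting
(`exists_table_without_circuit`) some truth table on the rows `0, …, t - 1` is not computed by any
circuit with `q` wires; let T₀ be the lexicographically first one. A language that lists T₀ at
length `n` has no small circuits there, but the obvious definition of T₀ is one alternation too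
complex: "every smaller table has a circuit" is a ∀∃ statement under the guess of the table.

The remedy is to guess, together with the table T, a circuit `D` that answers "what is bit `i` of
the first circuit for T'?". Then it suffices that for all T' below T the circuit assembled from the
answers of `D` computes T', which needs no inner existential quantifier. The question that `D`
answers is itself of the form ∃M ∀M', so it is put into the same language at length `l = n ^ (4 *
K)`; the last input bit tells the two kinds of inputs apart.

Soundness needs no assumption on `D`: an accepted table has no circuit and all smaller ones have
circuits, so it is T₀. Completeness needs a correct `D`, and a small circuit for the language at
length `l` is one (`query_mem_hardLanguage_iff`). So if there were small circuits at both lengths,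
the language would list T₀ at length `n` (`row_mem_hardLanguage_iff`) and the circuit for length `n`
would compute T₀, a contradiction (`not_decides_hardLanguage`). A robust set contains two such
polynomially related lengths.

For membership in Σ₂ᵖ the matrix has to be decided by a Turing machine in polynomial time.
Evaluating a circuit is replaced by checking guessed wire values; since these exist and are unique,
they can be quantified existentially or universally as needed. The matrix then becomes an arithmetic
formula whose quantifiers range over positions of the input (`definable_hardPredicate`). Such a
formula is decided by a program for a two-way multihead automaton, and a stack machine simulates the
automaton. The time is polynomial because a halting run repeats none of its polynomially many
configurations. -/

/-! ### Programs for two-way multihead automata -/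

/-- The elementary instructions of a two-way multihead automaton; each of them returns a bit. -/
inductive HeadOp (S : Type) : Type where
  | ret (b : Bool)
  | inc (i : ℕ)
  | dec (i : ℕ)
  | read (c : S) (i : ℕ)

/-- The bit returned by an instruction and the new head positions. A head cannot leave
the interval from `0` to the length of the input. -/
def HeadOp.exec {S : Type} [DecidableEq S] (s : List S) (v : ℕ → ℕ) :
    HeadOp S → Bool × (ℕ → ℕ)
  | .ret b => (b, v)
  | .inc i => if v i < s.length then (true, Function.update v i (v i + 1)) else (false, v)
  | .dec i => if 0 < v i then (true, Function.update v i (v i - 1)) else (false, v)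
  | .read c i => (decide (s[v i]? = some c), v)

/-- Structured programs; `loop c` repeats `c` as long as it returns `true`. -/
inductive HeadProg (S : Type) : Type where
  | op (o : HeadOp S)
  | ite (c p q : HeadProg S)
  | loop (c : HeadProg S)

/-- `Run s p v b v'`: on the input `s` and from the head positions `v`, the program `p` halts with
result `b` and head positions `v'`. -/
inductive HeadProg.Run {S : Type} [DecidableEq S] (s : List S) :
    HeadProg S → (ℕ → ℕ) → Bool → (ℕ → ℕ) → Prop where
  | op (o : HeadOp S) (v : ℕ → ℕ) : Run s (.op o) v (o.exec s v).1 (o.exec s v).2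
  | ite_true {c p q : HeadProg S} {v v' v'' : ℕ → ℕ} {b : Bool} :
      Run s c v true v' → Run s p v' b v'' → Run s (.ite c p q) v b v''
  | ite_false {c p q : HeadProg S} {v v' v'' : ℕ → ℕ} {b : Bool} :
      Run s c v false v' → Run s q v' b v'' → Run s (.ite c p q) v b v''
  | loop_done {c : HeadProg S} {v v' : ℕ → ℕ} : Run s c v false v' → Run s (.loop c) v true v'
  | loop_step {c : HeadProg S} {v v' v'' : ℕ → ℕ} :
      Run s c v true v' → Run s (.loop c) v' true v'' → Run s (.loop c) v true v''

/-! ### The automaton of a structured program -/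

namespace HeadProg

variable {S : Type}

/-- The control states of a program: its occurrences of elementary instructions. -/
def Pos : HeadProg S → Type
  | .op _ => Unit
  | .ite c p q => c.Pos ⊕ (p.Pos ⊕ q.Pos)
  | .loop c => c.Pos

instance fintypePos : (p : HeadProg S) → Fintype p.Pos
  | .op _ => inferInstanceAs (Fintype Unit)
  | .ite c p q =>
      letI := fintypePos c; letI := fintypePos p; letI := fintypePos q
      inferInstanceAs (Fintype (c.Pos ⊕ (p.Pos ⊕ q.Pos)))
  | .loop c => fintypePos c

/-- The first control state. -/
def entry : (p : HeadProg S) → p.Pos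
  | .op _ => ()
  | .ite c _ _ => Sum.inl c.entry
  | .loop c => c.entry

/-- The instruction executed in a control state. -/
def instr : (p : HeadProg S) → p.Pos → HeadOp S
  | .op o, _ => o
  | .ite c _ _, .inl x => c.instr x
  | .ite _ p _, .inr (.inl x) => p.instr x
  | .ite _ _ q, .inr (.inr x) => q.instr x
  | .loop c, x => c.instr x

/-- The continuation of a conditional after its condition. -/
def iteCont (c p q : HeadProg S) : c.Pos ⊕ Bool → (ite c p q).Pos ⊕ Bool
  | .inl x => .inl (.inl x)
  | .inr true => .inl (.inr (.inl p.entry))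
  | .inr false => .inl (.inr (.inr q.entry))

/-- The embedding of the first branch of a conditional. -/
def iteLeft (c p q : HeadProg S) : p.Pos ⊕ Bool → (ite c p q).Pos ⊕ Bool
  | .inl x => .inl (.inr (.inl x))
  | .inr b => .inr b

/-- The embedding of the second branch of a conditional. -/
def iteRight (c p q : HeadProg S) : q.Pos ⊕ Bool → (ite c p q).Pos ⊕ Bool
  | .inl x => .inl (.inr (.inr x))
  | .inr b => .inr b

/-- The continuation of a loop after its body. -/
def loopCont (c : HeadProg S) : c.Pos ⊕ Bool → (loop c).Pos ⊕ Bool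
  | .inl x => .inl x
  | .inr true => .inl c.entry
  | .inr false => .inr true

/-- The next control state, or the result of the program, after an instruction that
returned `b`. -/
def next : (p : HeadProg S) → p.Pos → Bool → p.Pos ⊕ Bool
  | .op _, _, b => .inr b
  | .ite c p q, .inl x, b => iteCont c p q (c.next x b)
  | .ite c p q, .inr (.inl x), b => iteLeft c p q (p.next x b)
  | .ite c p q, .inr (.inr x), b => iteRight c p q (q.next x b)
  | .loop c, x, b => loopCont c (c.next x b)

/-- The transition function of the automaton of a program. -/
def step [DecidableEq S] (s : List S) (p : HeadProg S) :
    (p.Pos ⊕ Bool) × (ℕ → ℕ) → Option ((p.Pos ⊕ Bool) × (ℕ → ℕ))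
  | (.inl x, v) => some (p.next x ((p.instr x).exec s v).1, ((p.instr x).exec s v).2)
  | (.inr _, _) => none

/-- Reachability in the automaton of a program. -/
def Reach [DecidableEq S] (s : List S) (p : HeadProg S) :
    (p.Pos ⊕ Bool) × (ℕ → ℕ) → (p.Pos ⊕ Bool) × (ℕ → ℕ) → Prop :=
  Relation.ReflTransGen fun a b => p.step s a = some b

/-- Results have no successor, so compatibility is needed only at control states. Hence `g` may send
a result of a part to a control state of the whole, which is how runs of the parts of a conditional
or loop are glued. -/
theorem Reach.map [DecidableEq S] {s : List S} {p p' : HeadProg S}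
    (g : p.Pos ⊕ Bool → p'.Pos ⊕ Bool)
    (hg : ∀ x v, p'.step s (g (.inl x), v) =
      (p.step s (.inl x, v)).map (Prod.map g id))
    {a b : (p.Pos ⊕ Bool) × (ℕ → ℕ)} (h : p.Reach s a b) :
    p'.Reach s (g a.1, a.2) (g b.1, b.2) := by
  refine Relation.ReflTransGen.lift (Prod.map g id) ?_ _ _ h
  rintro ⟨x | b, v⟩ c hc
  · change p'.step s (g (.inl x), v) = _
    rw [hg, hc, Option.map_some]
  · simp [step] at hc

theorem Run.reach [DecidableEq S] {s : List S} {p : HeadProg S} {v v' : ℕ → ℕ} {b : Bool}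
    (h : Run s p v b v') : p.Reach s (.inl p.entry, v) (.inr b, v') := by
  induction h with
  | op o v => exact Relation.ReflTransGen.single rfl
  | @ite_true c p q v v' v'' b _ _ ih₁ ih₂ =>
    have h₁ := ih₁.map (iteCont c p q) (fun x v => rfl)
    have h₂ := ih₂.map (iteLeft c p q) (fun x v => rfl)
    exact h₁.trans h₂
  | @ite_false c p q v v' v'' b _ _ ih₁ ih₂ =>
    have h₁ := ih₁.map (iteCont c p q) (fun x v => rfl)
    have h₂ := ih₂.map (iteRight c p q) (fun x v => rfl)
    exact h₁.trans h₂
  | @loop_done c v v' _ ih => exact ih.map (loopCont c) (fun x v => rfl)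
  | @loop_step c v v' v'' _ _ ih₁ ih₂ =>
    have h₁ := ih₁.map (loopCont c) (fun x v => rfl)
    exact h₁.trans ih₂

/-- A bound for the indices of the heads used by a program. -/
def bound : HeadProg S → ℕ
  | .op (.ret _) => 0
  | .op (.inc i) => i + 1
  | .op (.dec i) => i + 1
  | .op (.read _ i) => i + 1
  | .ite c p q => max c.bound (max p.bound q.bound)
  | .loop c => c.bound

end HeadProg

/-- All heads used by an instruction have an index below `r`. -/
def HeadOp.Below {S : Type} (r : ℕ) : HeadOp S → Prop
  | .ret _ => True
  | .inc i => i < r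
  | .dec i => i < r
  | .read _ i => i < r

theorem HeadProg.instr_below {S : Type} {r : ℕ} : (p : HeadProg S) → p.bound ≤ r →
    ∀ x, (p.instr x).Below r
  | .op o, h, _ => by cases o <;> simp_all [HeadOp.Below, instr, bound]
  | .ite c p q, h, x => by
    simp only [bound, max_le_iff] at h
    rcases x with x | x | x
    · exact c.instr_below h.1 x
    · exact p.instr_below h.2.1 x
    · exact q.instr_below h.2.2 x
  | .loop c, h, x => c.instr_below h x

/-! ### Length of halting runs -/

/-- Deterministic halting computations do not repeat a configuration. -/
theorem exists_iterate_lt_card {α β : Type} [Fintype β] (f : α → Option α) (I : α → Prop)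
    (code : α → β) (hcode : ∀ a b, I a → I b → code a = code b → a = b)
    (hI : ∀ a b, I a → f a = some b → I b) {a b : α} (ha : I a) (hb : f b = none)
    (h : Relation.ReflTransGen (fun a b => f a = some b) a b) :
    ∃ n < Fintype.card β, (flip bind f)^[n] (some a) = some b := by
  obtain ⟨n, hn⟩ : ∃ n, (flip bind f)^[n] (some a) = some b := by
    clear hb
    induction h with
    | refl => exact ⟨0, rfl⟩
    | tail _ hcd ih =>
      obtain ⟨n, hn⟩ := ih
      exact ⟨n + 1, by rw [Function.iterate_succ_apply', hn]; exact hcd⟩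
  refine ⟨n, ?_, hn⟩
  set g : ℕ → Option α := fun i => (flip bind f)^[i] (some a) with hg
  have hsucc : ∀ i, g (i + 1) = (g i).bind f := fun i => Function.iterate_succ_apply' _ _ _
  have hgn : g n = some b := hn
  have hnone : ∀ i m, g i = none → g (i + m) = none := by
    intro i m hi
    induction m with
    | zero => exact hi
    | succ m ih => rw [← add_assoc, hsucc, ih]; rfl
  have hshift : ∀ i j m, g i = g j → g (i + m) = g (j + m) := by
    intro i j m hij
    induction m with
    | zero => exact hij
    | succ m ih => rw [← add_assoc, ← add_assoc, hsucc, hsucc, ih]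
  have hend : g (n + 1) = none := by rw [hsucc, hgn]; exact hb
  have hsome : ∀ i ≤ n, ∃ x, g i = some x := by
    intro i hi
    rcases h : g i with _ | x
    · have := hnone i (n - i) h
      rw [Nat.add_sub_cancel' hi] at this
      rw [hgn] at this; simp at this
    · exact ⟨x, rfl⟩
  have hinv : ∀ i x, g i = some x → I x := by
    intro i
    induction i with
    | zero => intro x hx; obtain rfl : a = x := Option.some.inj hx; exact ha
    | succ i ih =>
      intro x hx
      rw [hsucc] at hx
      obtain ⟨y, hy, hyx⟩ := Option.bind_eq_some_iff.1 hx
      exact hI y x (ih y hy) hyx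
  -- A repetition at times `i < j` would carry the undefined value at time `n + 1` back to time `i +
  -- (n - j + 1) ≤ n`, where the run is still defined.
  have hne : ∀ i j, i < j → j ≤ n → g i ≠ g j := by
    intro i j hij hj h
    have := hshift i j (n - j + 1) h
    rw [show j + (n - j + 1) = n + 1 by omega, hend] at this
    obtain ⟨x, hx⟩ := hsome (i + (n - j + 1)) (by omega)
    rw [hx] at this; simp at this
  have : Nonempty α := ⟨a⟩
  choose! x hx using hsome
  have hinj : Function.Injective fun i : Fin (n + 1) => code (x i) := by
    intro i j hij
    have h1 := hx i (by omega)
    have h2 := hx j (by omega)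
    have h3 : x i = x j := hcode _ _ (hinv _ _ h1) (hinv _ _ h2) hij
    have h4 : g i = g j := by rw [h1, h2, h3]
    by_contra hne'
    rcases lt_or_gt_of_ne (fun h => hne' (Fin.ext h) : (i : ℕ) ≠ j) with h | h
    · exact hne _ _ h (by omega) h4
    · exact hne _ _ h (by omega) h4.symm
  have := Fintype.card_le_of_injective _ hinj
  simp only [Fintype.card_fin] at this
  omega

theorem HeadOp.exec_le {S : Type} [DecidableEq S] (s : List S) (v : ℕ → ℕ)
    (hv : ∀ i, v i ≤ s.length) (o : HeadOp S) : ∀ i, (o.exec s v).2 i ≤ s.length := by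
  intro j
  rcases o with b | i | i | ⟨c, i⟩
  · exact hv j
  · simp only [exec]
    split_ifs with h
    · by_cases hj : j = i
      · subst hj; simpa using h
      · simpa [hj] using hv j
    · exact hv j
  · simp only [exec]
    split_ifs with h
    · by_cases hj : j = i
      · subst hj; simpa using (Nat.sub_le _ _).trans (hv j)
      · simpa [hj] using hv j
    · exact hv j
  · exact hv j

theorem HeadOp.exec_of_le {S : Type} [DecidableEq S] (s : List S) (v : ℕ → ℕ) (o : HeadOp S)
    {r : ℕ} (ho : o.Below r) : ∀ j, r ≤ j → (o.exec s v).2 j = v j := by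
  intro j hj
  rcases o with b | i | i | ⟨c, i⟩
  · rfl
  · have : j ≠ i := by simp only [Below] at ho; omega
    simp only [exec]
    split_ifs <;> simp [this]
  · have : j ≠ i := by simp only [Below] at ho; omega
    simp only [exec]
    split_ifs <;> simp [this]
  · rfl

/-! ### Simulation of head programs by stack machines -/

namespace HeadProg

/-- The stacks of the machine simulating `r` heads: a head is a pair of stacks that hold the part
of the input to the left and to the right of it. -/
inductive Stk (r : ℕ) : Type where
  | inp
  | out
  | left (i : Fin r)
  | right (i : Fin r)
  deriving DecidableEq, Fintype

/-- The stack alphabets: the output is a string of bits. -/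
@[reducible] def stkAlphabet (S : Type) (r : ℕ) : Stk r → Type
  | .out => Bool
  | .inp => S
  | .left _ => S
  | .right _ => S

/-- The labels of the simulating machine. -/
inductive Lab (P : Type) : Type where
  | init
  | run (x : P)
  | clean (b : Bool)
  deriving Fintype

/-- The label of a control state or result. -/
def Lab.ofSum {P : Type} : P ⊕ Bool → Lab P
  | .inl x => .run x
  | .inr b => .clean b

variable {S : Type} {r : ℕ} {Λ : Type}

/-- The simulation of one instruction. -/
def opStmt [Inhabited S] [DecidableEq S] (r : ℕ) (k : Bool → Λ) :
    HeadOp S → Turing.TM2.Stmt (stkAlphabet S r) Λ (Option S)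
  | .ret b => .goto fun _ => k b
  | .inc i =>
      if h : i < r then
        .pop (.right ⟨i, h⟩) (fun _ o => o)
          (.branch Option.isSome
            (.push (.left ⟨i, h⟩) (fun v => v.getD default) (.goto fun _ => k true))
            (.goto fun _ => k false))
      else .halt
  | .dec i =>
      if h : i < r then
        .pop (.left ⟨i, h⟩) (fun _ o => o)
          (.branch Option.isSome
            (.push (.right ⟨i, h⟩) (fun v => v.getD default) (.goto fun _ => k true))
            (.goto fun _ => k false))
      else .halt
  | .read c i =>
      if h : i < r then
        .peek (.right ⟨i, h⟩) (fun _ o => o) (.goto fun v => k (decide (v = some c)))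
      else .halt

/-- Push the symbol in the register on the left stacks of all heads in the list. -/
def pushLeft [Inhabited S] (q : Turing.TM2.Stmt (stkAlphabet S r) Λ (Option S)) (l : List (Fin r)) :
    Turing.TM2.Stmt (stkAlphabet S r) Λ (Option S) :=
  l.foldr (fun i q => .push (.left i) (fun v => v.getD default) q) q

/-- Pop the left stacks of all heads in the list. -/
def popLeft (q : Turing.TM2.Stmt (stkAlphabet S r) Λ (Option S)) (l : List (Fin r)) :
    Turing.TM2.Stmt (stkAlphabet S r) Λ (Option S) :=
  l.foldr (fun i q => .pop (.left i) (fun _ o => o) q) q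

/-- The simulating machine. -/
def machineStmt [Inhabited S] [DecidableEq S] (p : HeadProg S) (r : ℕ) :
    Lab p.Pos → Turing.TM2.Stmt (stkAlphabet S r) (Lab p.Pos) (Option S)
  | .init => .pop .inp (fun _ o => o)
      (.branch Option.isSome (pushLeft (.goto fun _ => .init) (List.finRange r))
        (.goto fun _ => .run p.entry))
  | .run x => opStmt r (fun b => Lab.ofSum (p.next x b)) (p.instr x)
  | .clean b => popLeft (.branch Option.isSome (.goto fun _ => .clean b)
      (.push .out (fun _ => b) .halt)) (List.finRange r)

/-- The simulating machine as a bundled machine. -/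
def machine [Inhabited S] [DecidableEq S] [Fintype S] (p : HeadProg S) (r : ℕ) : Turing.FinTM2 where
  K := Stk r
  k₀ := .inp
  k₁ := .out
  Γ := stkAlphabet S r
  Λ := Lab p.Pos
  main := .init
  σ := Option S
  initialState := none
  Γk₀Fin := inferInstanceAs (Fintype S)
  m := machineStmt p r

/-- The stacks when the heads are at the positions `v`. -/
def headStacks (r : ℕ) (s : List S) (v : ℕ → ℕ) : ∀ k : Stk r, List (stkAlphabet S r k)
  | .inp => ([] : List S)
  | .out => ([] : List Bool)
  | .left i => ((s.take (v i)).reverse : List S)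
  | .right i => (s.drop (v i) : List S)

theorem headStacks_move (s : List S) (v : ℕ → ℕ) (i : Fin r) (m : ℕ)
    (a : List (stkAlphabet S r (.left i))) (b : List (stkAlphabet S r (.right i)))
    (ha : a = headStacks r s (Function.update v i m) (.left i))
    (hb : b = headStacks r s (Function.update v i m) (.right i)) :
    Function.update (Function.update (headStacks r s v) (.right i) b) (.left i) a =
      headStacks r s (Function.update v i m) := by
  subst ha hb
  funext k
  by_cases h₁ : k = .left i
  · subst h₁; rw [Function.update_self]
  rw [Function.update_of_ne h₁]
  by_cases h₂ : k = .right i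
  · subst h₂; rw [Function.update_self]
  rw [Function.update_of_ne h₂]
  rcases k with _ | _ | j | j
  · rfl
  · rfl
  · have h' : (j : ℕ) ≠ i := fun e => h₁ (by rw [Fin.ext e])
    simp only [headStacks, Function.update_of_ne h']
  · have h' : (j : ℕ) ≠ i := fun e => h₂ (by rw [Fin.ext e])
    simp only [headStacks, Function.update_of_ne h']

/-- The scanned symbol is the top of the right stack, and a move transfers one symbol between the
two stacks of a head, so an instruction costs one machine step. The register carries no information
between steps, so its new value is left unspecified. -/
theorem stepAux_opStmt [Inhabited S] [DecidableEq S] (s : List S) (v : ℕ → ℕ) (hv : ∀ i, v i ≤ s.length) (o : HeadOp S)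
    (ho : o.Below r) (k : Bool → Λ) (x : Option S) :
    ∃ x', Turing.TM2.stepAux (opStmt r k o) x (headStacks r s v) =
      ⟨some (k (o.exec s v).1), x', headStacks r s (o.exec s v).2⟩ := by
  rcases o with b | i | i | ⟨c, i⟩
  · exact ⟨_, rfl⟩
  · have hi : i < r := ho
    have hhead : (headStacks r s v (.right ⟨i, hi⟩)).head? = s[v i]? := List.head?_drop
    by_cases hlt : v i < s.length
    · refine ⟨some s[v i], ?_⟩
      simp only [opStmt, hi, dif_pos, Turing.TM2.stepAux, HeadOp.exec, hlt, if_true, hhead,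
        List.getElem?_eq_getElem, Option.isSome_some, cond_true, Option.getD_some]
      congr 1
      refine headStacks_move s v ⟨i, hi⟩ (v i + 1) _ _ ?_ ?_
      · rw [Function.update_of_ne (by simp)]
        change s[v i] :: (s.take (v i)).reverse =
          (s.take (Function.update v i (v i + 1) i)).reverse
        rw [Function.update_self, List.take_succ_eq_append_getElem hlt, List.reverse_append]
        rfl
      · simp [headStacks]
    · refine ⟨none, ?_⟩
      simp only [opStmt, hi, dif_pos, Turing.TM2.stepAux, HeadOp.exec, hlt, if_false, hhead,
        List.getElem?_eq_none (not_lt.1 hlt), Option.isSome_none, cond_false]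
      congr 1
      have : (headStacks r s v (.right ⟨i, hi⟩)) = ([] : List S) := List.drop_eq_nil_iff.2 (not_lt.1 hlt)
      rw [this]
      exact Function.update_eq_self_iff.2 this.symm
  · have hi : i < r := ho
    by_cases hlt : 0 < v i
    · have hl : v i - 1 < s.length := by have := hv i; omega
      have htake : s.take (v i) = s.take (v i - 1) ++ [s[v i - 1]] := by
        rw [← List.take_succ_eq_append_getElem hl, Nat.sub_add_cancel hlt]
      have hrev : (s.take (v i)).reverse = s[v i - 1] :: (s.take (v i - 1)).reverse := by
        rw [htake]; simp
      have hhead : (headStacks r s v (.left ⟨i, hi⟩)).head? = some s[v i - 1] :=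
        congrArg List.head? hrev
      have htail : (headStacks r s v (.left ⟨i, hi⟩)).tail = (s.take (v i - 1)).reverse :=
        congrArg List.tail hrev
      have hright : s.drop (v i - 1) = s[v i - 1] :: s.drop (v i) := by
        rw [List.drop_eq_getElem_cons hl]
        congr 2
        omega
      refine ⟨some s[v i - 1], ?_⟩
      simp only [opStmt, hi, dif_pos, Turing.TM2.stepAux, HeadOp.exec, hlt, if_true, hhead, htail,
        Option.isSome_some, cond_true, Option.getD_some]
      congr 1
      rw [Function.update_comm (by simp), Function.update_of_ne (by simp)]
      exact headStacks_move s v ⟨i, hi⟩ (v i - 1) _ _ (by simp [headStacks]) (by simp [headStacks, hright])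
    · have hrev : (s.take (v i)).reverse = [] := by
        rw [show v i = 0 by omega]; rfl
      have hhead : (headStacks r s v (.left ⟨i, hi⟩)).head? = none := congrArg List.head? hrev
      have htail : (headStacks r s v (.left ⟨i, hi⟩)).tail = headStacks r s v (.left ⟨i, hi⟩) :=
        (congrArg List.tail hrev).trans hrev.symm
      refine ⟨none, ?_⟩
      simp only [opStmt, hi, dif_pos, Turing.TM2.stepAux, HeadOp.exec, hlt, if_false, hhead, htail,
        Option.isSome_none, cond_false, Function.update_eq_self]
  · have hi : i < r := ho
    have hhead : (headStacks r s v (.right ⟨i, hi⟩)).head? = s[v i]? := List.head?_drop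
    refine ⟨s[v i]?, ?_⟩
    simp only [opStmt, hi, dif_pos, Turing.TM2.stepAux, HeadOp.exec, hhead]

/-- Stacks with a given remaining input, given left stacks, empty right stacks and a given
output. -/
def phaseStacks (a : List S) (f : Fin r → List S) (o : List Bool) :
    ∀ k : Stk r, List (stkAlphabet S r k)
  | .inp => a
  | .out => o
  | .left i => f i
  | .right _ => []

theorem update_phaseStacks (a : List S) (f : Fin r → List S) (o : List Bool) (i : Fin r)
    (l : List S) :
    Function.update (phaseStacks a f o) (.left i) l =
      phaseStacks a (Function.update f i l) o := by
  funext k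
  rcases k with _ | _ | j | j
  · rfl
  · rfl
  · by_cases h : j = i
    · subst h; rw [Function.update_self]; simp [phaseStacks]
    · rw [Function.update_of_ne (by simpa using h)]
      simp [phaseStacks, Function.update_of_ne h]
  · rfl

theorem stepAux_pushLeft [Inhabited S]
    (q : Turing.TM2.Stmt (stkAlphabet S r) Λ (Option S)) (x : Option S) (a : List S)
    (o : List Bool) (l : List (Fin r)) (hl : l.Nodup) (f : Fin r → List S) :
    Turing.TM2.stepAux (pushLeft q l) x (phaseStacks a f o) =
      Turing.TM2.stepAux q x
        (phaseStacks a (fun i => if i ∈ l then x.getD default :: f i else f i) o) := by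
  induction l generalizing f with
  | nil => simp [pushLeft]
  | cons i l ih =>
    obtain ⟨hi, hl⟩ := List.nodup_cons.1 hl
    change Turing.TM2.stepAux (pushLeft q l) x
      (Function.update (phaseStacks a f o) (.left i) (x.getD default :: f i)) = _
    rw [update_phaseStacks, ih hl]
    congr 2
    funext j
    by_cases hj : j = i
    · subst hj; simp [hi]
    · simp [hj]

theorem stepAux_popLeft
    (q : Turing.TM2.Stmt (stkAlphabet S r) Λ (Option S)) (x : Option S) (a : List S)
    (o : List Bool) (l : List (Fin r)) (hl : l.Nodup) (f : Fin r → List S) (w : List S)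
    (hf : ∀ i ∈ l, f i = w) :
    Turing.TM2.stepAux (popLeft q l) x (phaseStacks a f o) =
      Turing.TM2.stepAux q (if l = [] then x else w.head?)
        (phaseStacks a (fun i => if i ∈ l then w.tail else f i) o) := by
  induction l generalizing f x with
  | nil => simp [popLeft]
  | cons i l ih =>
    obtain ⟨hi, hl⟩ := List.nodup_cons.1 hl
    change Turing.TM2.stepAux (popLeft q l) (f i).head?
      (Function.update (phaseStacks a f o) (.left i) (f i).tail) = _
    rw [update_phaseStacks, hf i (by simp), ih _ hl]
    · congr 1
      · simp
      · congr 1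
        funext j
        by_cases hj : j = i
        · subst hj; simp [hi]
        · simp [hj]
    · intro j hj
      rw [Function.update_of_ne (fun e : j = i => hi (e ▸ hj))]
      exact hf j (by simp [hj])

theorem update_inp_phaseStacks (a a' : List S) (f : Fin r → List S) (o : List Bool) :
    Function.update (phaseStacks a f o) .inp a' = phaseStacks a' f o := by
  funext k
  rcases k with _ | _ | j | j <;> rfl

theorem update_out_phaseStacks (a : List S) (f : Fin r → List S) (o o' : List Bool) :
    Function.update (phaseStacks a f o) .out o' = phaseStacks a f o' := by
  funext k
  rcases k with _ | _ | j | j <;> rfl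

/-- Copying the input to the left stacks reverses it, so every head starts at the right end. The
additional step is the pop that finds the input stack empty. -/
theorem init_steps [Inhabited S] [DecidableEq S] (p : HeadProg S) (r : ℕ) (a w : List S)
    (x : Option S) :
    (flip bind (Turing.TM2.step (machineStmt p r)))^[a.length + 1]
      (some ⟨some .init, x, phaseStacks a (fun _ => w) []⟩) =
      some ⟨some (.run p.entry), none, phaseStacks [] (fun _ => a.reverse ++ w) []⟩ := by
  induction a generalizing w x with
  | nil =>
    change some (Turing.TM2.stepAux (.goto fun _ => Lab.run p.entry) none
      (Function.update (phaseStacks [] (fun _ => w) []) .inp ([] : List S))) = _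
    rw [update_inp_phaseStacks]
    rfl
  | cons c a ih =>
    rw [List.length_cons, Function.iterate_succ_apply]
    have h : flip bind (Turing.TM2.step (machineStmt p r))
        (some ⟨some .init, x, phaseStacks (c :: a) (fun _ => w) []⟩) =
        some ⟨some .init, some c, phaseStacks a (fun _ => c :: w) []⟩ := by
      change some (Turing.TM2.stepAux (pushLeft (.goto fun _ => Lab.init (P := p.Pos)) (List.finRange r)) (some c)
        (Function.update (phaseStacks (c :: a) (fun _ => w) []) .inp a)) = _
      rw [update_inp_phaseStacks, stepAux_pushLeft _ _ _ _ _ (List.nodup_finRange r)]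
      simp
    rw [h, ih]
    simp

/-- All left stacks are equal here, so the last pop, which determines the register, tells whether
all of them were empty. Without a head nothing would reload the register. -/
theorem clean_steps [Inhabited S] [DecidableEq S] (p : HeadProg S) (r : ℕ) (hr : 0 < r) (b : Bool)
    (w : List S) (x : Option S) :
    (flip bind (Turing.TM2.step (machineStmt p r)))^[w.length + 1]
      (some ⟨some (.clean b), x, phaseStacks [] (fun _ => w) []⟩) =
      some ⟨none, none, phaseStacks [] (fun _ => []) [b]⟩ := by
  have hne : List.finRange r ≠ [] := by
    intro h
    have := congrArg List.length h
    simp at this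
    omega
  have hstep : ∀ (w : List S) (x : Option S), flip bind (Turing.TM2.step (machineStmt p r))
      (some ⟨some (.clean b), x, phaseStacks [] (fun _ => w) []⟩) =
      some (Turing.TM2.stepAux (.branch Option.isSome (.goto fun _ => .clean b)
        (.push .out (fun _ => b) .halt)) w.head? (phaseStacks [] (fun _ => w.tail) [])) := by
    intro w x
    change some (Turing.TM2.stepAux (popLeft _ (List.finRange r)) x _) = _
    rw [stepAux_popLeft _ _ _ _ _ (List.nodup_finRange r) _ w (fun _ _ => rfl)]
    simp [hne]
  induction w generalizing x with
  | nil =>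
    rw [List.length_nil, Function.iterate_one, hstep]
    change some (⟨none, none, Function.update (phaseStacks [] (fun _ => []) []) .out [b]⟩ :
      Turing.TM2.Cfg (stkAlphabet S r) (Lab p.Pos) (Option S)) = _
    rw [update_out_phaseStacks]
  | cons c w ih =>
    rw [List.length_cons, Function.iterate_succ_apply, hstep]
    exact ih (some c)

theorem run_steps [Inhabited S] [DecidableEq S] (p : HeadProg S) (r : ℕ) (hr : p.bound ≤ r)
    (s : List S) (n : ℕ) (c d : (p.Pos ⊕ Bool) × (ℕ → ℕ)) (hc : ∀ i, c.2 i ≤ s.length)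
    (h : (flip bind (p.step s))^[n] (some c) = some d) (x : Option S) :
    ∃ x', (flip bind (Turing.TM2.step (machineStmt p r)))^[n]
      (some ⟨some (Lab.ofSum c.1), x, headStacks r s c.2⟩) =
      some ⟨some (Lab.ofSum d.1), x', headStacks r s d.2⟩ := by
  induction n generalizing c x with
  | zero =>
    obtain rfl : c = d := Option.some.inj h
    exact ⟨x, rfl⟩
  | succ n ih =>
    rw [Function.iterate_succ_apply] at h
    rcases c with ⟨y | b, v⟩
    · obtain ⟨x₁, hx₁⟩ := stepAux_opStmt s v hc (p.instr y) (p.instr_below hr y)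
        (fun b => Lab.ofSum (p.next y b)) x
      obtain ⟨x', hx'⟩ := ih (p.next y ((p.instr y).exec s v).1, ((p.instr y).exec s v).2)
        (HeadOp.exec_le s v hc _) h x₁
      refine ⟨x', ?_⟩
      rw [Function.iterate_succ_apply, ← hx']
      congr 1
      exact congrArg some hx₁
    · have hnone : ∀ n, (flip bind (p.step s))^[n] none = none := by
        intro n
        induction n with
        | zero => rfl
        | succ n ih => rw [Function.iterate_succ_apply]; exact ih
      have : flip bind (p.step s) (some (.inr b, v)) = none := rfl
      rw [this, hnone] at h
      simp at h

theorem initList_machine [Inhabited S] [DecidableEq S] [Fintype S] (p : HeadProg S) (r : ℕ)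
    (s : List S) :
    Turing.initList (machine p r) s =
      (⟨some .init, none, phaseStacks s (fun _ => []) []⟩ :
        Turing.TM2.Cfg (stkAlphabet S r) (Lab p.Pos) (Option S)) := by
  refine congrArg (Turing.TM2.Cfg.mk _ _) ?_
  funext k
  rcases k with _ | _ | j | j <;> rfl

theorem haltList_machine [Inhabited S] [DecidableEq S] [Fintype S] (p : HeadProg S) (r : ℕ)
    (o : List Bool) :
    Turing.haltList (machine p r) o =
      (⟨none, none, phaseStacks [] (fun _ => []) o⟩ :
        Turing.TM2.Cfg (stkAlphabet S r) (Lab p.Pos) (Option S)) := by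
  refine congrArg (Turing.TM2.Cfg.mk _ _) ?_
  funext k
  rcases k with _ | _ | j | j <;> rfl

/-- The program starts and ends with its heads at the right end because loading leaves them there
and cleaning empties only the left stacks. The time is the number of configurations plus two passes
over the input. -/
theorem machine_outputs [Inhabited S] [DecidableEq S] [Fintype S] (p : HeadProg S) (r : ℕ)
    (hr : 0 < r) (hp : p.bound ≤ r) (s : List S) (b : Bool)
    (h : Run s p (fun i => if i < r then s.length else 0) b
      (fun i => if i < r then s.length else 0)) :
    ∃ n ≤ (Fintype.card (p.Pos ⊕ Bool) * (s.length + 1) ^ r) + (2 * s.length + 2),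
      (flip bind (machine p r).step)^[n] (some (Turing.initList (machine p r) s)) =
        some (Turing.haltList (machine p r) [b]) := by
  set v : ℕ → ℕ := fun i => if i < r then s.length else 0 with hv
  obtain ⟨n, hn, hrun⟩ := exists_iterate_lt_card
    -- Configurations are coded by the control state and the first `r` positions; the invariant
    -- keeps positions within the input and the unused heads at `0`, which makes the code injective.
    (β := (p.Pos ⊕ Bool) × (Fin r → Fin (s.length + 1))) (p.step s)
    (fun c => (∀ i, c.2 i ≤ s.length) ∧ ∀ i, r ≤ i → c.2 i = 0)
    (fun c => (c.1, fun i => Fin.ofNat (s.length + 1) (c.2 i)))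
    (by
      rintro ⟨x, v⟩ ⟨y, w⟩ ⟨hv, hv'⟩ ⟨hw, hw'⟩ hxy
      obtain ⟨hx, hy⟩ := Prod.mk.inj hxy
      refine Prod.ext hx (funext fun i => ?_)
      by_cases hi : i < r
      · have := congrArg Fin.val (congrFun hy ⟨i, hi⟩)
        simpa [Fin.ofNat, Nat.mod_eq_of_lt (Nat.lt_succ_of_le (hv i)),
          Nat.mod_eq_of_lt (Nat.lt_succ_of_le (hw i))] using this
      · exact (hv' i (not_lt.1 hi)).trans (hw' i (not_lt.1 hi)).symm)
    (by
      rintro ⟨x | x, v⟩ c ⟨hv, hv'⟩ hc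
      · obtain rfl := Option.some.inj hc
        refine ⟨HeadOp.exec_le s v hv _, fun i hi => ?_⟩
        exact (HeadOp.exec_of_le s v _ (p.instr_below hp x) i hi).trans (hv' i hi)
      · simp [step] at hc)
    (a := (.inl p.entry, v)) (b := (.inr b, v))
    ⟨fun i => by simp only [hv]; split_ifs <;> simp, fun i hi => by simp [hv, not_lt.2 hi]⟩
    rfl h.reach
  obtain ⟨x', hx'⟩ := run_steps p r hp s n (.inl p.entry, v) (.inr b, v)
    (fun i => by simp only [hv]; split_ifs <;> simp) hrun none
  have hstacks : headStacks r s v = phaseStacks [] (fun _ => s.reverse) [] := by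
    funext k
    rcases k with _ | _ | j | j
    · rfl
    · rfl
    · simp [headStacks, phaseStacks, hv]
    · simp [headStacks, phaseStacks, hv]
  refine ⟨(s.length + 1) + (n + (s.length + 1)), ?_, ?_⟩
  · rw [Fintype.card_prod, Fintype.card_fun, Fintype.card_fin, Fintype.card_fin] at hn
    omega
  · have h₁ := init_steps p r s [] none
    have h₂ := clean_steps p r hr b s.reverse x'
    rw [List.length_reverse] at h₂
    rw [hstacks] at hx'
    rw [List.append_nil] at h₁
    have h₃ : (flip bind (Turing.TM2.step (machineStmt p r)))^[(s.length + 1) +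
        (n + (s.length + 1))] (some ⟨some .init, none, phaseStacks s (fun _ => []) []⟩) =
        some ⟨none, none, phaseStacks [] (fun _ => []) [b]⟩ := by
      rw [Function.iterate_add_apply _ (s.length + 1), Function.iterate_add_apply _ n, h₁]
      exact (congrArg _ hx').trans h₂
    exact (congrArg _ (congrArg some (initList_machine p r s))).trans
      (h₃.trans (congrArg some (haltList_machine p r [b]).symm))

/-! ### Normalizing head positions and the passage to polynomial time -/

theorem Run.seq [DecidableEq S] {s : List S} {p q : HeadProg S} {v v' v'' : ℕ → ℕ} {b b' : Bool}
    (h : Run s p v b v') (h' : Run s q v' b' v'') : Run s (.ite p q q) v b' v'' := by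
  cases b
  · exact .ite_false h h'
  · exact .ite_true h h'

/-- Move the heads with index below `r` to the left end. -/
def resetAll : ℕ → HeadProg S
  | 0 => .op (.ret true)
  | r + 1 => .ite (resetAll r) (.loop (.op (.dec r))) (.loop (.op (.dec r)))

/-- Move the heads with index below `r` to the right end. -/
def setAll : ℕ → HeadProg S
  | 0 => .op (.ret true)
  | r + 1 => .ite (setAll r) (.loop (.op (.inc r))) (.loop (.op (.inc r)))

theorem run_loop_dec [DecidableEq S] (s : List S) (i : ℕ) (v : ℕ → ℕ) :
    Run s (.loop (.op (.dec i))) v true (Function.update v i 0) := by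
  induction h : v i generalizing v with
  | zero =>
    have := Run.op (s := s) (.dec i) v
    rw [HeadOp.exec, if_neg (by omega)] at this
    rw [← h, Function.update_eq_self]
    exact .loop_done this
  | succ n ih =>
    have := Run.op (s := s) (.dec i) v
    rw [HeadOp.exec, if_pos (by omega)] at this
    refine .loop_step this ?_
    have := ih (Function.update v i (v i - 1)) (by simp [h])
    simpa using this

theorem run_loop_inc [DecidableEq S] (s : List S) (i : ℕ) (v : ℕ → ℕ) (hv : v i ≤ s.length) :
    Run s (.loop (.op (.inc i))) v true (Function.update v i s.length) := by
  induction h : s.length - v i generalizing v with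
  | zero =>
    have := Run.op (s := s) (.inc i) v
    rw [HeadOp.exec, if_neg (by omega)] at this
    rw [show s.length = v i by omega, Function.update_eq_self]
    exact .loop_done this
  | succ n ih =>
    have := Run.op (s := s) (.inc i) v
    rw [HeadOp.exec, if_pos (by omega)] at this
    refine .loop_step this ?_
    have := ih (Function.update v i (v i + 1)) (by simp; omega) (by simp; omega)
    simpa using this

theorem run_resetAll [DecidableEq S] (s : List S) (r : ℕ) (v : ℕ → ℕ) :
    Run s (resetAll r) v true (fun i => if i < r then 0 else v i) := by
  induction r with
  | zero => exact .op _ _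
  | succ r ih =>
    refine .ite_true ih ?_
    convert run_loop_dec s r _ using 1
    funext i
    by_cases h : i = r
    · subst h; simp
    · rw [Function.update_of_ne h]
      simp only [show i < r + 1 ↔ i < r by omega]

theorem run_setAll [DecidableEq S] (s : List S) (r : ℕ) (v : ℕ → ℕ) (hv : ∀ i, v i ≤ s.length) :
    Run s (setAll r) v true (fun i => if i < r then s.length else v i) := by
  induction r with
  | zero => exact .op _ _
  | succ r ih =>
    refine .ite_true ih ?_
    convert run_loop_inc s r _ ?_ using 1
    · funext i
      by_cases h : i = r
      · subst h; simp
      · rw [Function.update_of_ne h]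
        simp only [show i < r + 1 ↔ i < r by omega]
    · simpa using hv r

theorem bound_resetAll (r : ℕ) : (resetAll r : HeadProg S).bound ≤ r := by
  induction r with
  | zero => simp [resetAll, bound]
  | succ r ih => simp only [resetAll, bound]; omega

theorem bound_setAll (r : ℕ) : (setAll r : HeadProg S).bound ≤ r := by
  induction r with
  | zero => simp [setAll, bound]
  | succ r ih => simp only [setAll, bound]; omega

/-- Predicates decided by head programs are decidable in polynomial time. -/
theorem nonempty_tm2ComputableInPolyTime [Inhabited S] [DecidableEq S] [Fintype S] {α : Type}
    (ea : α → List S) (f : α → Bool) (p : HeadProg S)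
    (h : ∀ a, Run (ea a) p (fun _ => 0) (f a) (fun _ => 0)) :
    Nonempty (Turing.TM2ComputableInPolyTime ea Computability.encodeBool f) := by
  -- The additional head makes `r` positive, as the cleaning phase requires. The program `p'` brings
  -- the heads to the left end, runs `p`, and brings them back to the right end while remembering
  -- the result in its control state.
  set r := p.bound + 1 with hr
  let p' : HeadProg S := .ite (resetAll r) (.ite p (.ite (setAll r) (.op (.ret true))
    (.op (.ret true))) (.ite (setAll r) (.op (.ret false)) (.op (.ret false))))
    (.op (.ret false))
  have hp' : p'.bound ≤ r := by
    have h₁ := bound_resetAll (S := S) r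
    have h₂ := bound_setAll (S := S) r
    simp only [p', bound]
    omega
  have hrun : ∀ a, Run (ea a) p' (fun i => if i < r then (ea a).length else 0) (f a)
      (fun i => if i < r then (ea a).length else 0) := by
    intro a
    have h₁ := run_resetAll (ea a) r (fun i => if i < r then (ea a).length else 0)
    have h₂ := run_setAll (ea a) r (fun _ => 0) (fun _ => Nat.zero_le _)
    have h₃ := h a
    refine .ite_true (v' := fun _ => 0) (by convert h₁ using 1; funext i; split_ifs <;> rfl) ?_
    cases hb : f a
    · rw [hb] at h₃
      exact .ite_false h₃ (h₂.seq (.op (.ret false) _))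
    · rw [hb] at h₃
      exact .ite_true h₃ (h₂.seq (.op (.ret true) _))
  have hout := fun a => machine_outputs p' r (by omega) hp' (ea a) (f a) (hrun a)
  exact ⟨{
    tm := machine p' r
    inputAlphabet := Equiv.refl S
    outputAlphabet := Equiv.refl Bool
    time := Polynomial.C (Fintype.card (p'.Pos ⊕ Bool)) * (Polynomial.X + 1) ^ r +
      (2 * Polynomial.X + 2)
    outputsFun := fun a =>
      { steps := (hout a).choose
        evals_in_steps := by
          have := (hout a).choose_spec.2
          convert this using 3
          · exact congrArg _ (List.map_id _)
          · rfl
        steps_le_m := by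
          have := (hout a).choose_spec.1
          simpa using this } }⟩

end HeadProg

/-! ### Arithmetic with head positions -/

namespace HeadProg

variable {S : Type} [DecidableEq S] {s : List S}

theorem run_ret (b : Bool) (v : ℕ → ℕ) : Run s (.op (.ret b)) v b v := .op _ _

theorem run_inc (i : ℕ) (v : ℕ → ℕ) (h : v i < s.length) :
    Run s (.op (.inc i)) v true (Function.update v i (v i + 1)) := by
  have := Run.op (s := s) (.inc i) v
  rwa [HeadOp.exec, if_pos h] at this

theorem run_inc_sat (i : ℕ) (v : ℕ → ℕ) (h : v i ≤ s.length) :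
    ∃ b, Run s (.op (.inc i)) v b (Function.update v i (min (v i + 1) s.length)) := by
  by_cases h' : v i < s.length
  · rw [min_eq_left h']
    exact ⟨true, run_inc i v h'⟩
  · have := Run.op (s := s) (.inc i) v
    rw [HeadOp.exec, if_neg h'] at this
    rw [min_eq_right (by omega), show s.length = v i by omega, Function.update_eq_self]
    exact ⟨_, this⟩

theorem run_dec (i : ℕ) (v : ℕ → ℕ) (h : 0 < v i) :
    Run s (.op (.dec i)) v true (Function.update v i (v i - 1)) := by
  have := Run.op (s := s) (.dec i) v
  rwa [HeadOp.exec, if_pos h] at this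

theorem run_dec_zero (i : ℕ) (v : ℕ → ℕ) (h : v i = 0) : Run s (.op (.dec i)) v false v := by
  have := Run.op (s := s) (.dec i) v
  rwa [HeadOp.exec, if_neg (by omega)] at this

theorem run_dec_sub (i : ℕ) (v : ℕ → ℕ) :
    ∃ b, Run s (.op (.dec i)) v b (Function.update v i (v i - 1)) := by
  by_cases h : 0 < v i
  · exact ⟨true, run_dec i v h⟩
  · refine ⟨false, ?_⟩
    rw [show v i - 1 = v i by omega, Function.update_eq_self]
    exact run_dec_zero i v (by omega)

theorem Run.cast {p : HeadProg S} {v v' u u' : ℕ → ℕ} {b : Bool} (h : Run s p v b v')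
    (hv : v = u) (hv' : v' = u') : Run s p u b u' := hv ▸ hv' ▸ h

/-- Sequential composition; the result is that of the second program. -/
def andThen (p q : HeadProg S) : HeadProg S := .ite p q q

theorem Run.andThen {p q : HeadProg S} {v v' v'' : ℕ → ℕ} {b' : Bool}
    (h : ∃ b, Run s p v b v') (h' : Run s q v' b' v'') : Run s (p.andThen q) v b' v'' := by
  obtain ⟨b, h⟩ := h
  exact h.seq h'

/-- `while c do p`. -/
def whileDo (c p : HeadProg S) : HeadProg S :=
  .loop (.ite c (p.andThen (.op (.ret true))) (.op (.ret false)))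

theorem run_whileDo_stop {c p : HeadProg S} {v v' : ℕ → ℕ} (h : Run s c v false v') :
    Run s (whileDo c p) v true v' :=
  .loop_done (.ite_false h (run_ret _ _))

theorem run_whileDo_step {c p : HeadProg S} {v v₁ v₂ v₃ : ℕ → ℕ} (h₁ : Run s c v true v₁)
    (h₂ : ∃ b, Run s p v₁ b v₂) (h₃ : Run s (whileDo c p) v₂ true v₃) :
    Run s (whileDo c p) v true v₃ :=
  .loop_step (.ite_true h₁ (Run.andThen h₂ (run_ret _ _))) h₃

/-- The head `a` is moved to the left end; the other heads that are moved by the body move by a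
fixed function of the position of `a`. -/
theorem run_whileDo_dec {a : ℕ} {p : HeadProg S} (f : ℕ → ℕ → ℕ) (m : ℕ) (hf : ∀ n ≤ m, f n a = n)
    (hp : ∀ n < m, ∃ b, Run s p (Function.update (f (n + 1)) a n) b (f n)) :
    Run s (whileDo (.op (.dec a)) p) (f m) true (f 0) := by
  induction m with
  | zero => exact run_whileDo_stop (run_dec_zero _ _ (hf 0 le_rfl))
  | succ m ih =>
    have h := run_dec (s := s) a (f (m + 1)) (by rw [hf _ le_rfl]; omega)
    rw [hf _ le_rfl, Nat.add_sub_cancel] at h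
    exact run_whileDo_step h (hp m (by omega)) (ih (fun n hn => hf n (by omega))
      (fun n hn => hp n (by omega)))

/-- Add the position of head `a` to that of head `b`. -/
def move (a b : ℕ) : HeadProg S := whileDo (.op (.dec a)) (.op (.inc b))

theorem run_move {a b : ℕ} (hab : a ≠ b) (v : ℕ → ℕ) (hv : v a + v b ≤ s.length) :
    Run s (move a b) v true (Function.update (Function.update v a 0) b (v a + v b)) := by
  refine (run_whileDo_dec (s := s) (a := a) (p := .op (.inc b))
    (fun n => Function.update (Function.update v a n) b (v a + v b - n)) (v a)
    (fun n _ => by simp [hab]) (fun n hn => ⟨true, ?_⟩)).cast (by simp) (by simp)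
  refine (run_inc b (Function.update (Function.update v a n) b (v a + v b - (n + 1)))
    (by simp; omega)).cast ?_ ?_ <;> funext j <;> simp only [Function.update_apply] <;> grind

/-- Add the position of head `a` to those of heads `b` and `c`. -/
def move₂ (a b c : ℕ) : HeadProg S :=
  whileDo (.op (.dec a)) (andThen (.op (.inc b)) (.op (.inc c)))

/-- Head `b` must hold the exact sum, since it serves to restore a value; head `c` accumulates and
is allowed to saturate at the right end. -/
theorem run_move₂ {a b c : ℕ} (hab : a ≠ b) (hac : a ≠ c) (hbc : b ≠ c) (v : ℕ → ℕ)
    (hb : v a + v b ≤ s.length) (hc : v c ≤ s.length) :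
    Run s (move₂ a b c) v true (Function.update (Function.update (Function.update v a 0)
      b (v a + v b)) c (min (v a + v c) s.length)) := by
  refine (run_whileDo_dec (s := s) (a := a) (p := andThen (.op (.inc b)) (.op (.inc c)))
    (fun n => Function.update (Function.update (Function.update v a n) b (v a + v b - n))
      c (min (v a + v c - n) s.length)) (v a)
    (fun n _ => by simp [hab, hac]) (fun n hn => ?_)).cast (by simp [hc]) (by simp)
  have h₁ := run_inc (s := s) b (Function.update (Function.update
    (Function.update v a n) b (v a + v b - (n + 1)))
    c (min (v a + v c - (n + 1)) s.length)) (by simp [hbc]; omega)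
  obtain ⟨b', h₂⟩ := run_inc_sat (s := s) c (Function.update (Function.update
    (Function.update v a n) b (v a + v b - n))
    c (min (v a + v c - (n + 1)) s.length)) (by simp)
  refine ⟨b', Run.andThen ⟨true, h₁.cast ?_ ?_⟩ (h₂.cast rfl ?_)⟩ <;> funext j <;>
    simp only [Function.update_apply] <;> grind

/-- Copy the position of head `i` to head `a`, with the help of head `b`. -/
def copy (i a b : ℕ) : HeadProg S := andThen (move i b) (move₂ b i a)

theorem run_copy {i a b : ℕ} (hia : i ≠ a) (hib : i ≠ b) (hab : a ≠ b) (v : ℕ → ℕ)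
    (hv : v i ≤ s.length) (ha : v a = 0) (hb : v b = 0) :
    Run s (copy i a b) v true (Function.update v a (v i)) := by
  have h₁ := run_move (s := s) hib v (by omega)
  have h₂ := run_move₂ (s := s) hib.symm hab.symm hia
    (Function.update (Function.update v i 0) b (v i + v b)) (by simp [hib]; omega)
    (by simp [hab, hia.symm]; omega)
  refine (Run.andThen ⟨_, h₁⟩ h₂).cast rfl ?_
  funext j
  simp only [Function.update_apply]
  grind

/-- Subtract the position of head `a` from that of head `b`. -/
def subtract (a b : ℕ) : HeadProg S := whileDo (.op (.dec a)) (.op (.dec b))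

theorem run_subtract {a b : ℕ} (hab : a ≠ b) (v : ℕ → ℕ) :
    Run s (subtract a b) v true (Function.update (Function.update v a 0) b (v b - v a)) := by
  refine (run_whileDo_dec (s := s) (a := a) (p := .op (.dec b))
    (fun n => Function.update (Function.update v a n) b (v b - (v a - n))) (v a)
    (fun n _ => by simp [hab]) (fun n hn => ?_)).cast (by simp) (by simp)
  obtain ⟨b', h⟩ := run_dec_sub (s := s) b (Function.update (Function.update v a n) b
    (v b - (v a - (n + 1))))
  refine ⟨b', h.cast ?_ ?_⟩ <;> funext j <;> simp only [Function.update_apply] <;> grind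

/-- Add the product of the positions of heads `a` and `b` to that of head `d`, with the help of
head `c`, and move `a` to the left end. -/
def addMul (a b c d : ℕ) : HeadProg S :=
  whileDo (.op (.dec a)) (andThen (move₂ b c d) (move c b))

theorem run_addMul {a b c d : ℕ} (hab : a ≠ b) (hac : a ≠ c) (had : a ≠ d) (hbc : b ≠ c)
    (hbd : b ≠ d) (hcd : c ≠ d) (v : ℕ → ℕ) (hb : v b ≤ s.length) (hc : v c = 0)
    (hd : v d ≤ s.length) :
    Run s (addMul a b c d) v true (Function.update (Function.update v a 0) d
      (min (v d + v a * v b) s.length)) := by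
  refine (run_whileDo_dec (s := s) (a := a) (p := andThen (move₂ b c d) (move c b))
    (fun n => Function.update (Function.update v a n) d
      (min (v d + (v a - n) * v b) s.length)) (v a)
    (fun n _ => by simp [had]) (fun n hn => ⟨true, ?_⟩)).cast (by simp [hd]) (by simp)
  have h₁ := run_move₂ (s := s) hbc hbd hcd (Function.update (Function.update v a n) d
      (min (v d + (v a - (n + 1)) * v b) s.length)) (by simp [hab.symm, hac.symm, hbd, hcd]; omega)
      (by simp)
  have h₂ := run_move (s := s) hbc.symm (Function.update (Function.update
    (Function.update (Function.update v a n) d (min (v d + (v a - n) * v b) s.length))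
      b 0) c (v b)) (by simp [hbc]; omega)
  have hmul : (v a - n) * v b = (v a - (n + 1)) * v b + v b := by
    rw [← Nat.succ_mul]; congr 1; omega
  refine Run.andThen ⟨true, h₁.cast ?_ ?_⟩ (h₂.cast rfl ?_) <;> funext j <;>
    simp only [Function.update_apply] <;> grind

end HeadProg

open HeadProg

/-! ### Predicates decided by head programs -/

/-- The predicate `P` of the input and of the positions of the heads `0, …, d - 1` is decided by
a program that uses the other heads as auxiliary heads. -/
def HeadDecidable {S : Type} [DecidableEq S] (d : ℕ) (P : List S → (ℕ → ℕ) → Prop) : Prop :=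
  ∃ p : HeadProg S, ∀ s w, (∀ i, w i ≤ s.length) → (∀ i, d ≤ i → w i = 0) →
    ∃ b, (b = true ↔ P s w) ∧ Run s p w b w

/-- The function `f` of the input and of the positions of the heads `0, …, d - 1` is computed
on head `d`. -/
def HeadComputable {S : Type} [DecidableEq S] (d : ℕ) (f : List S → (ℕ → ℕ) → ℕ) : Prop :=
  ∃ p : HeadProg S, ∀ s w, (∀ i, w i ≤ s.length) → (∀ i, d ≤ i → w i = 0) →
    ∃ b, Run s p w b (Function.update w d (f s w))

namespace HeadDecidable

variable {S : Type} [DecidableEq S] {d : ℕ} {P Q : List S → (ℕ → ℕ) → Prop}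

theorem congr (hP : HeadDecidable d P)
    (h : ∀ s w, (∀ i, w i ≤ s.length) → (∀ i, d ≤ i → w i = 0) → (P s w ↔ Q s w)) :
    HeadDecidable d Q := by
  obtain ⟨p, hp⟩ := hP
  refine ⟨p, fun s w hw hd => ?_⟩
  obtain ⟨b, hb, hr⟩ := hp s w hw hd
  exact ⟨b, hb.trans (h s w hw hd), hr⟩

theorem not (hP : HeadDecidable d P) : HeadDecidable d fun s w => ¬ P s w := by
  obtain ⟨p, hp⟩ := hP
  refine ⟨.ite p (.op (.ret false)) (.op (.ret true)), fun s w hw hd => ?_⟩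
  obtain ⟨b, hb, hr⟩ := hp s w hw hd
  cases b
  · exact ⟨true, by simpa using hb, .ite_false hr (run_ret _ _)⟩
  · exact ⟨false, by simpa using hb, .ite_true hr (run_ret _ _)⟩

theorem and (hP : HeadDecidable d P) (hQ : HeadDecidable d Q) :
    HeadDecidable d fun s w => P s w ∧ Q s w := by
  obtain ⟨p, hp⟩ := hP
  obtain ⟨q, hq⟩ := hQ
  refine ⟨.ite p q (.op (.ret false)), fun s w hw hd => ?_⟩
  obtain ⟨b, hb, hr⟩ := hp s w hw hd
  obtain ⟨b', hb', hr'⟩ := hq s w hw hd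
  cases b
  · exact ⟨false, by simp only [← hb]; simp, .ite_false hr (run_ret _ _)⟩
  · exact ⟨b', by simp only [← hb, hb']; simp, .ite_true hr hr'⟩

/-- The value is stored on head `d`, tested there, and erased again, so that all heads end where
they started. -/
theorem call {f : List S → (ℕ → ℕ) → ℕ} (hP : HeadDecidable (d + 1) P) (hf : HeadComputable d f)
    (hle : ∀ s w, (∀ i, w i ≤ s.length) → f s w ≤ s.length) :
    HeadDecidable d fun s w => P s (Function.update w d (f s w)) := by
  obtain ⟨p, hp⟩ := hP
  obtain ⟨q, hq⟩ := hf
  refine ⟨andThen q (.ite p (andThen (.loop (.op (.dec d))) (.op (.ret true)))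
    (andThen (.loop (.op (.dec d))) (.op (.ret false)))), fun s w hw hd => ?_⟩
  obtain ⟨b', hq'⟩ := hq s w hw hd
  obtain ⟨b, hb, hr⟩ := hp s (Function.update w d (f s w))
    (fun i => by
      rw [Function.update_apply]; split_ifs
      · exact hle s w hw
      · exact hw i)
    (fun i hi => by rw [Function.update_of_ne (by omega)]; exact hd i (by omega))
  have h₁ := run_loop_dec s d (Function.update w d (f s w))
  rw [Function.update_idem, (Function.update_eq_self_iff.2 (hd d le_rfl).symm :
    Function.update w d 0 = w)] at h₁
  refine ⟨b, hb, Run.andThen ⟨b', hq'⟩ ?_⟩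
  cases b
  · exact .ite_false hr (Run.andThen ⟨_, h₁⟩ (run_ret _ _))
  · exact .ite_true hr (Run.andThen ⟨_, h₁⟩ (run_ret _ _))

theorem exists_le (hP : HeadDecidable (d + 1) P) :
    HeadDecidable d fun s w => ∃ a ≤ s.length, P s (Function.update w d a) := by
  obtain ⟨p, hp⟩ := hP
  -- Head `d` sweeps to the right until `P` holds or it cannot move. Either way the sweep stops at
  -- this infimum, and one more test of `P` there decides whether a witness exists.
  have hsearch : HeadComputable d fun s w =>
      sInf {a | a = s.length ∨ P s (Function.update w d a)} := by
    refine ⟨.loop (.ite p (.op (.ret false)) (.op (.inc d))), fun s w hw hd => ⟨true, ?_⟩⟩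
    set m := sInf {a | a = s.length ∨ P s (Function.update w d a)} with hm
    have hmem : m = s.length ∨ P s (Function.update w d m) :=
      Nat.sInf_mem (s := {a | a = s.length ∨ P s (Function.update w d a)}) ⟨_, Or.inl rfl⟩
    have hmin : ∀ a, a < m → ¬ (a = s.length ∨ P s (Function.update w d a)) :=
      fun a ha => Nat.notMem_of_lt_sInf ha
    have hml : m ≤ s.length := Nat.sInf_le (Or.inl rfl)
    have hvalid : ∀ a ≤ s.length, ∃ b, (b = true ↔ P s (Function.update w d a)) ∧
        Run s p (Function.update w d a) b (Function.update w d a) := by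
      intro a ha
      refine hp s _ (fun i => ?_) (fun i hi => ?_)
      · rw [Function.update_apply]; split_ifs
        · exact ha
        · exact hw i
      · rw [Function.update_of_ne (by omega)]; exact hd i (by omega)
    have key : ∀ k ≤ m, Run s (.loop (.ite p (.op (.ret false)) (.op (.inc d))))
        (Function.update w d (m - k)) true (Function.update w d m) := by
      intro k
      induction k with
      | zero =>
        intro _
        refine .loop_done ?_
        obtain ⟨b, hb, hr⟩ := hvalid m hml
        cases b
        · refine .ite_false hr ?_
          have hP : ¬ P s (Function.update w d m) := by simpa using hb
          have := Run.op (s := s) (.inc d) (Function.update w d m)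
          rwa [HeadOp.exec, if_neg (by simp [hmem.resolve_right hP])] at this
        · exact .ite_true hr (run_ret _ _)
      | succ k ih =>
        intro hk
        obtain ⟨b, hb, hr⟩ := hvalid (m - (k + 1)) (by omega)
        have hno := hmin (m - (k + 1)) (by omega)
        have hP : ¬ P s (Function.update w d (m - (k + 1))) := fun h => hno (Or.inr h)
        have hb' : b = false := by simpa using mt hb.1 hP
        subst hb'
        have h₁ := run_inc (s := s) d (Function.update w d (m - (k + 1))) (by simp; omega)
        refine .loop_step (.ite_false hr (h₁.cast rfl ?_)) (ih (by omega))
        simp only [Function.update_idem, Function.update_self]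
        congr 1
        omega
    refine (key m le_rfl).cast ?_ rfl
    rw [Nat.sub_self]
    exact Function.update_eq_self_iff.2 (hd d le_rfl).symm
  refine (call ⟨p, hp⟩ hsearch fun s w _ => Nat.sInf_le (Or.inl rfl)).congr fun s w hw hd => ?_
  set m := sInf {a | a = s.length ∨ P s (Function.update w d a)} with hm
  constructor
  · exact fun h => ⟨m, Nat.sInf_le (Or.inl rfl), h⟩
  · rintro ⟨a, ha, h⟩
    have hmem : m = s.length ∨ P s (Function.update w d m) :=
      Nat.sInf_mem (s := {a | a = s.length ∨ P s (Function.update w d a)}) ⟨_, Or.inl rfl⟩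
    rcases hmem with hmem | hmem
    · have : m ≤ a := Nat.sInf_le (Or.inr h)
      obtain rfl : m = a := by omega
      exact h
    · exact hmem

theorem eq_zero {i : ℕ} : HeadDecidable (S := S) d fun _ w => w i = 0 := by
  refine ⟨.ite (.op (.dec i)) (andThen (.op (.inc i)) (.op (.ret false))) (.op (.ret true)),
    fun s w hw hd => ?_⟩
  by_cases h : w i = 0
  · exact ⟨true, by simp [h], .ite_false (run_dec_zero _ _ h) (run_ret _ _)⟩
  · refine ⟨false, by simp [h], .ite_true (run_dec i w (by omega))
      (Run.andThen ⟨true, ?_⟩ (run_ret _ _))⟩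
    have := hw i
    refine (run_inc i (Function.update w i (w i - 1)) (by simp; omega)).cast rfl ?_
    simp only [Function.update_idem, Function.update_self]
    exact Function.update_eq_self_iff.2 (by omega)

theorem read {i : ℕ} (c : S) : HeadDecidable d fun s w => s[w i]? = some c :=
  ⟨.op (.read c i), fun s w _ _ => ⟨decide (s[w i]? = some c), by simp, Run.op (.read c i) w⟩⟩

theorem _root_.HeadComputable.sub {i j : ℕ} (hi : i < d) (hj : j < d) :
    HeadComputable (S := S) d fun _ w => w i - w j := by
  refine ⟨andThen (copy i d (d + 1)) (andThen (copy j (d + 1) (d + 2)) (subtract (d + 1) d)),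
    fun s w hw hd => ⟨true, ?_⟩⟩
  have h₀ := hd d le_rfl
  have h₁ := hd (d + 1) (by omega)
  have h₂ := hd (d + 2) (by omega)
  have r₁ := run_copy (s := s) (i := i) (a := d) (b := d + 1) (by omega) (by omega) (by omega) w
    (hw i) h₀ h₁
  have r₂ := run_copy (s := s) (i := j) (a := d + 1) (b := d + 2) (by omega) (by omega) (by omega)
    (Function.update w d (w i)) (by rw [Function.update_of_ne (by omega)]; exact hw j)
    (by rw [Function.update_of_ne (by omega)]; exact h₁)
    (by rw [Function.update_of_ne (by omega)]; exact h₂)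
  have r₃ := run_subtract (s := s) (a := d + 1) (b := d) (by omega)
    (Function.update (Function.update w d (w i)) (d + 1) (Function.update w d (w i) j))
  refine Run.andThen ⟨_, r₁⟩ (Run.andThen ⟨_, r₂⟩ (r₃.cast rfl ?_))
  funext k
  simp only [Function.update_apply]
  grind

theorem _root_.HeadComputable.mul {i j : ℕ} (hi : i < d) (hj : j < d) :
    HeadComputable (S := S) d fun s w => min (w i * w j) s.length := by
  refine ⟨andThen (copy i (d + 1) (d + 3)) (andThen (copy j (d + 2) (d + 3))
    (andThen (addMul (d + 1) (d + 2) (d + 3) d) (.loop (.op (.dec (d + 2)))))),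
    fun s w hw hd => ⟨true, ?_⟩⟩
  have h₀ := hd d le_rfl
  have h₁ := hd (d + 1) (by omega)
  have h₂ := hd (d + 2) (by omega)
  have h₃ := hd (d + 3) (by omega)
  have r₁ := run_copy (s := s) (i := i) (a := d + 1) (b := d + 3) (by omega) (by omega) (by omega) w
    (hw i) h₁ h₃
  have r₂ := run_copy (s := s) (i := j) (a := d + 2) (b := d + 3) (by omega) (by omega) (by omega)
    (Function.update w (d + 1) (w i)) (by rw [Function.update_of_ne (by omega)]; exact hw j)
    (by rw [Function.update_of_ne (by omega)]; exact h₂)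
    (by rw [Function.update_of_ne (by omega)]; exact h₃)
  rw [Function.update_of_ne (by omega : j ≠ d + 1)] at r₂
  have r₃ := run_addMul (s := s) (a := d + 1) (b := d + 2) (c := d + 3) (d := d) (by omega)
    (by omega) (by omega) (by omega) (by omega) (by omega)
    (Function.update (Function.update w (d + 1) (w i)) (d + 2) (w j))
    (by simpa using hw j) (by simpa using h₃) (by simp [h₀])
  have r₄ := run_loop_dec s (d + 2) (Function.update (Function.update (Function.update
    (Function.update w (d + 1) (w i)) (d + 2) (w j)) (d + 1) 0) d (min (w i * w j) s.length))
  refine Run.andThen ⟨_, r₁⟩ (Run.andThen ⟨_, r₂⟩ (Run.andThen ⟨_, r₃.cast rfl ?_⟩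
    (r₄.cast rfl ?_))) <;> funext k <;> simp only [Function.update_apply] <;> grind

theorem or (hP : HeadDecidable d P) (hQ : HeadDecidable d Q) :
    HeadDecidable d fun s w => P s w ∨ Q s w :=
  (hP.not.and hQ.not).not.congr fun _ _ _ _ => by tauto

theorem le {i j : ℕ} (hi : i < d) (hj : j < d) :
    HeadDecidable (S := S) d fun _ w => w i ≤ w j := by
  refine ((eq_zero (d := d + 1) (i := d)).call (HeadComputable.sub hi hj)
    fun s w hw => (Nat.sub_le _ _).trans (hw i)).congr fun s w _ _ => ?_
  rw [Function.update_self]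
  omega

theorem eq {i j : ℕ} (hi : i < d) (hj : j < d) :
    HeadDecidable (S := S) d fun _ w => w i = w j :=
  ((le hi hj).and (le hj hi)).congr fun _ _ _ _ => by omega

theorem add_eq {i j k : ℕ} (hi : i < d) (hj : j < d) (hk : k < d) :
    HeadDecidable (S := S) d fun _ w => w i + w j = w k := by
  refine ((le hi hk).and ((eq (d := d + 1) (i := d) (j := j) (by omega) (by omega)).call
    (HeadComputable.sub hk hi)
    fun s w hw => (Nat.sub_le _ _).trans (hw k))).congr fun s w _ _ => ?_
  rw [Function.update_self, Function.update_of_ne (by omega)]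
  omega

/-- One is the nonzero position that has no nonzero position strictly below it. -/
theorem eq_one {i : ℕ} (hi : i < d) : HeadDecidable (S := S) d fun _ w => w i = 1 := by
  refine ((eq_zero (d := d) (i := i)).not.and ((eq_zero (d := d + 1) (i := d)).not.and
    (le (d := d + 1) (i := i) (j := d) (by omega) (by omega)).not).exists_le.not).congr
    fun s w hw _ => ?_
  simp only [Function.update_self, Function.update_of_ne (show i ≠ d by omega)]
  have := hw i
  constructor
  · rintro ⟨h0, h⟩
    by_contra h1
    exact h ⟨1, by omega, by omega, by omega⟩
  · intro h
    refine ⟨by omega, ?_⟩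
    rintro ⟨a, _, h1, h2⟩
    omega

/-- A product truncated at the length of the input could be mistaken for a product equal to that
length. With nonzero factors one therefore tests `w i * (w j - 1) + w i = w k`: if the product on
the left is truncated, adding `w i` exceeds every position. -/
theorem mul_eq {i j k : ℕ} (hi : i < d) (hj : j < d) (hk : k < d) :
    HeadDecidable (S := S) d fun _ w => w i * w j = w k := by
  refine ((((eq_zero (i := i)).or (eq_zero (i := j))).and (eq_zero (i := k))).or
    ((eq_zero (i := i)).not.and
    ((eq_one (d := d + 2) (i := d + 1) (by omega)).and
      ((add_eq (d := d + 2) (i := d) (j := d + 1) (k := j) (by omega) (by omega) (by omega)).and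
      ((add_eq (d := d + 3) (i := d + 2) (j := i) (k := k) (by omega) (by omega) (by omega)).call
      (HeadComputable.mul (d := d + 2) (i := i) (j := d) (by omega) (by omega))
      fun s w _ => min_le_right _ _))).exists_le.exists_le)).congr fun s w hw _ => ?_
  simp only [Function.update_self, Function.update_of_ne (show i ≠ d by omega),
    Function.update_of_ne (show i ≠ d + 1 by omega), Function.update_of_ne (show i ≠ d + 2 by omega),
    Function.update_of_ne (show j ≠ d by omega), Function.update_of_ne (show j ≠ d + 1 by omega),
    Function.update_of_ne (show k ≠ d by omega), Function.update_of_ne (show k ≠ d + 1 by omega),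
    Function.update_of_ne (show k ≠ d + 2 by omega), Function.update_of_ne (show d ≠ d + 1 by omega)]
  have h₁ := hw i
  have h₂ := hw j
  have h₃ := hw k
  constructor
  · rintro (⟨h | h, h'⟩ | ⟨h, a, _, b, _, rfl, hb, hc⟩)
    · simp [h, h']
    · simp [h, h']
    · rw [← hb, Nat.mul_add, mul_one]
      omega
  · intro h
    by_cases hi0 : w i = 0
    · left; exact ⟨Or.inl hi0, by simpa [hi0] using h.symm⟩
    by_cases hj0 : w j = 0
    · left; exact ⟨Or.inr hj0, by simpa [hj0] using h.symm⟩
    right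
    refine ⟨hi0, w j - 1, by omega, 1, by omega, rfl, by omega, ?_⟩
    have : w i * (w j - 1) + w i = w k := by
      rw [← h, ← Nat.mul_succ]; congr 1; omega
    omega

end HeadDecidable

/-! ### Arithmetic terms -/

/-- Arithmetic terms in the positions of the heads. -/
inductive HeadTerm : Type where
  | var (i : ℕ)
  | const (c : ℕ)
  | add (t u : HeadTerm)
  | mul (t u : HeadTerm)

namespace HeadTerm

/-- The value of a term. -/
def val (w : ℕ → ℕ) : HeadTerm → ℕ
  | .var i => w i
  | .const c => c
  | .add t u => t.val w + u.val w
  | .mul t u => t.val w * u.val w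

/-- The heads in a term have an index below `d`. -/
def Below (d : ℕ) : HeadTerm → Prop
  | .var i => i < d
  | .const _ => True
  | .add t u => t.Below d ∧ u.Below d
  | .mul t u => t.Below d ∧ u.Below d

theorem Below.mono {d e : ℕ} (h : d ≤ e) : {t : HeadTerm} → t.Below d → t.Below e
  | .var _, ht => lt_of_lt_of_le ht h
  | .const _, _ => trivial
  | .add _ _, ht => ⟨ht.1.mono h, ht.2.mono h⟩
  | .mul _ _, ht => ⟨ht.1.mono h, ht.2.mono h⟩

theorem val_congr {d : ℕ} {w w' : ℕ → ℕ} (h : ∀ i < d, w i = w' i) :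
    {t : HeadTerm} → t.Below d → t.val w = t.val w'
  | .var _, ht => h _ ht
  | .const _, _ => rfl
  | .add _ _, ht => congrArg₂ (· + ·) (val_congr h ht.1) (val_congr h ht.2)
  | .mul _ _, ht => congrArg₂ (· * ·) (val_congr h ht.1) (val_congr h ht.2)

theorem val_update {d k a : ℕ} (w : ℕ → ℕ) {t : HeadTerm} (ht : t.Below d) (hk : d ≤ k) :
    t.val (Function.update w k a) = t.val w :=
  val_congr (fun i hi => Function.update_of_ne (by omega) _ _) ht

theorem headDecidable_const {S : Type} [DecidableEq S] (c d i : ℕ) (hi : i < d) :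
    HeadDecidable (S := S) d fun _ w => c = w i := by
  induction c generalizing d i with
  | zero => exact HeadDecidable.eq_zero.congr fun _ _ _ _ => eq_comm
  | succ c ih =>
    refine ((ih (d + 2) d (by omega)).and ((HeadDecidable.eq_one (d := d + 2) (i := d + 1)
      (by omega)).and (HeadDecidable.add_eq (d := d + 2) (i := d) (j := d + 1) (k := i) (by omega)
      (by omega) (by omega)))).exists_le.exists_le.congr fun s w hw _ => ?_
    simp only [Function.update_self, Function.update_of_ne (show i ≠ d by omega),
      Function.update_of_ne (show i ≠ d + 1 by omega),
      Function.update_of_ne (show d ≠ d + 1 by omega)]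
    have := hw i
    constructor
    · rintro ⟨a, _, b, _, rfl, rfl, h⟩
      exact h
    · intro h
      exact ⟨c, by omega, 1, by omega, rfl, rfl, h⟩

theorem headDecidable_val_eq {S : Type} [DecidableEq S] (t : HeadTerm) (d i : ℕ) (ht : t.Below d)
    (hi : i < d) : HeadDecidable (S := S) d fun _ w => t.val w = w i := by
  induction t generalizing d i with
  | var j => exact HeadDecidable.eq ht hi
  | const c => exact headDecidable_const c d i hi
  | add t u iht ihu =>
    refine ((iht (d + 2) d (ht.1.mono (by omega)) (by omega)).and
      ((ihu (d + 2) (d + 1) (ht.2.mono (by omega)) (by omega)).and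
      (HeadDecidable.add_eq (d := d + 2) (i := d) (j := d + 1) (k := i) (by omega)
      (by omega) (by omega)))).exists_le.exists_le.congr fun s w hw _ => ?_
    simp only [Function.update_self, Function.update_of_ne (show i ≠ d by omega),
      Function.update_of_ne (show i ≠ d + 1 by omega),
      Function.update_of_ne (show d ≠ d + 1 by omega), val_update _ ht.1 (le_refl d),
      val_update _ ht.1 (Nat.le_succ d), val_update _ ht.2 (le_refl d),
      val_update _ ht.2 (Nat.le_succ d)]
    have := hw i
    constructor
    · rintro ⟨a, _, b, _, rfl, rfl, h⟩
      exact h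
    · intro h
      simp only [val] at h
      exact ⟨_, by omega, _, by omega, rfl, rfl, h⟩
  | mul t u iht ihu =>
    -- The values of subterms are guessed as positions. In a nonzero product equal to a position
    -- both factors are positions, but next to a zero factor the other one may be too large, so that
    -- case is separate.
    have h₀ : ∀ t : HeadTerm, (∀ d i, t.Below d → i < d →
        HeadDecidable (S := S) d fun _ w => t.val w = w i) → t.Below d →
        HeadDecidable (S := S) d fun _ w => t.val w = 0 := by
      intro t ih ht
      refine ((ih (d + 1) d (ht.mono (by omega)) (by omega)).and
        (HeadDecidable.eq_zero (i := d))).exists_le.congr fun s w _ _ => ?_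
      simp only [Function.update_self, val_update _ ht (le_refl d)]
      constructor
      · rintro ⟨a, _, h, rfl⟩
        exact h
      · intro h
        exact ⟨0, by omega, h, rfl⟩
    refine ((((h₀ t iht ht.1).or (h₀ u ihu ht.2)).and (HeadDecidable.eq_zero (i := i))).or
      ((iht (d + 2) d (ht.1.mono (by omega)) (by omega)).and
      ((ihu (d + 2) (d + 1) (ht.2.mono (by omega)) (by omega)).and
      (HeadDecidable.mul_eq (d := d + 2) (i := d) (j := d + 1) (k := i) (by omega)
      (by omega) (by omega)))).exists_le.exists_le).congr fun s w hw _ => ?_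
    simp only [Function.update_self, Function.update_of_ne (show i ≠ d by omega),
      Function.update_of_ne (show i ≠ d + 1 by omega),
      Function.update_of_ne (show d ≠ d + 1 by omega), val_update _ ht.1 (le_refl d),
      val_update _ ht.1 (Nat.le_succ d), val_update _ ht.2 (le_refl d),
      val_update _ ht.2 (Nat.le_succ d), val]
    have := hw i
    constructor
    · rintro (⟨h | h, h'⟩ | ⟨a, _, b, _, rfl, rfl, h⟩)
      · simp [h, h']
      · simp [h, h']
      · exact h
    · intro h
      by_cases h₁ : t.val w = 0
      · left; exact ⟨Or.inl h₁, by simpa [h₁] using h.symm⟩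
      by_cases h₂ : u.val w = 0
      · left; exact ⟨Or.inr h₂, by simpa [h₂] using h.symm⟩
      right
      have h₃ := Nat.le_mul_of_pos_right (t.val w) (Nat.pos_of_ne_zero h₂)
      have h₄ := Nat.le_mul_of_pos_left (u.val w) (Nat.pos_of_ne_zero h₁)
      exact ⟨_, by omega, _, by omega, rfl, rfl, h⟩

end HeadTerm

/-! ### Bounded formulas over the positions of a string -/

/-- Types of tuples of natural numbers, stored on the heads `0, …, depth - 1`. -/
class HeadContext (α : Type) where
  depth : ℕ
  pos : α → ℕ → ℕ
  pos_of_le : ∀ a i, depth ≤ i → pos a i = 0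

instance : HeadContext Unit := ⟨0, fun _ _ => 0, fun _ _ _ => rfl⟩

instance {α : Type} [HeadContext α] : HeadContext (α × ℕ) where
  depth := HeadContext.depth α + 1
  pos p := Function.update (HeadContext.pos p.1) (HeadContext.depth α) p.2
  pos_of_le p i hi := by
    rw [Function.update_of_ne (by omega)]
    exact HeadContext.pos_of_le _ _ (by omega)

open HeadContext

/-- Components of the context. -/
def DefinableVar {α : Type} [HeadContext α] (f : α → ℕ) : Prop :=
  ∃ i < depth α, ∀ a, pos a i = f a

/-- Arithmetic terms in the components of the context. -/
def DefinableTerm {α : Type} [HeadContext α] (f : α → ℕ) : Prop :=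
  ∃ t : HeadTerm, t.Below (depth α) ∧ ∀ a, t.val (pos a) = f a

/-- Predicates of a string and of a tuple of positions in it that are decided by a head program. -/
def Definable {S : Type} [DecidableEq S] {α : Type} [HeadContext α] (P : List S → α → Prop) :
    Prop :=
  ∃ Q, HeadDecidable (depth α) Q ∧
    ∀ s a, (∀ i, pos a i ≤ s.length) → (Q s (pos a) ↔ P s a)

section

variable {α : Type} {_ : HeadContext α} {f g x y : α → ℕ}

theorem DefinableVar.snd : DefinableVar fun p : α × ℕ => p.2 :=
  ⟨depth α, Nat.lt_succ_self _, fun _ => Function.update_self _ _ _⟩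

theorem DefinableVar.fst (h : DefinableVar x) : DefinableVar fun p : α × ℕ => x p.1 := by
  obtain ⟨i, hi, h⟩ := h
  exact ⟨i, Nat.lt_succ_of_lt hi, fun p => (Function.update_of_ne (by omega) _ _).trans (h p.1)⟩

theorem DefinableVar.term (h : DefinableVar x) : DefinableTerm x := by
  obtain ⟨i, hi, h⟩ := h
  exact ⟨.var i, hi, h⟩

theorem DefinableTerm.const (c : ℕ) : DefinableTerm fun _ : α => c := ⟨.const c, trivial, fun _ => rfl⟩

theorem DefinableTerm.add (hf : DefinableTerm f) (hg : DefinableTerm g) :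
    DefinableTerm fun a => f a + g a := by
  obtain ⟨t, ht, hf⟩ := hf
  obtain ⟨u, hu, hg⟩ := hg
  exact ⟨.add t u, ⟨ht, hu⟩, fun a => congrArg₂ (· + ·) (hf a) (hg a)⟩

theorem DefinableTerm.mul (hf : DefinableTerm f) (hg : DefinableTerm g) :
    DefinableTerm fun a => f a * g a := by
  obtain ⟨t, ht, hf⟩ := hf
  obtain ⟨u, hu, hg⟩ := hg
  exact ⟨.mul t u, ⟨ht, hu⟩, fun a => congrArg₂ (· * ·) (hf a) (hg a)⟩

theorem DefinableTerm.pow (hf : DefinableTerm f) (n : ℕ) : DefinableTerm fun a => f a ^ n := by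
  induction n with
  | zero => exact DefinableTerm.const 1
  | succ n ih => exact ih.mul hf

theorem DefinableTerm.fst (h : DefinableTerm f) : DefinableTerm fun p : α × ℕ => f p.1 := by
  obtain ⟨t, ht, h⟩ := h
  exact ⟨t, ht.mono (Nat.le_succ _), fun p => (HeadTerm.val_update _ ht le_rfl).trans (h p.1)⟩

theorem DefinableVar.le {n : ℕ} (h : DefinableVar x) {a : α} (ha : ∀ i, pos a i ≤ n) :
    x a ≤ n := by
  obtain ⟨i, _, h⟩ := h
  exact h a ▸ ha i

end

namespace Definable

variable {S : Type} {_ : DecidableEq S} {α : Type} {_ : HeadContext α} {P Q : List S → α → Prop}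
  {R : List S → α → ℕ → Prop} {f g x y : α → ℕ}

theorem congr (hP : Definable P)
    (h : ∀ s a, (∀ i, pos a i ≤ s.length) → (P s a ↔ Q s a)) : Definable Q := by
  obtain ⟨P', hP', hP⟩ := hP
  exact ⟨P', hP', fun s a ha => (hP s a ha).trans (h s a ha)⟩

theorem not (hP : Definable P) : Definable fun s a => ¬ P s a := by
  obtain ⟨P', hP', hP⟩ := hP
  exact ⟨_, hP'.not, fun s a ha => not_congr (hP s a ha)⟩

theorem and (hP : Definable P) (hQ : Definable Q) : Definable fun s a => P s a ∧ Q s a := by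
  obtain ⟨P', hP', hP⟩ := hP
  obtain ⟨Q', hQ', hQ⟩ := hQ
  exact ⟨_, hP'.and hQ', fun s a ha => and_congr (hP s a ha) (hQ s a ha)⟩

theorem or (hP : Definable P) (hQ : Definable Q) : Definable fun s a => P s a ∨ Q s a :=
  (hP.not.and hQ.not).not.congr fun _ _ _ => by tauto

theorem imp (hP : Definable P) (hQ : Definable Q) : Definable fun s a => P s a → Q s a :=
  (hP.and hQ.not).not.congr fun _ _ _ => by tauto

theorem iff (hP : Definable P) (hQ : Definable Q) : Definable fun s a => P s a ↔ Q s a :=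
  ((hP.imp hQ).and (hQ.imp hP)).congr fun _ _ _ => by tauto

theorem exists_le (hR : Definable fun s (p : α × ℕ) => R s p.1 p.2) :
    Definable fun s a => ∃ b ≤ s.length, R s a b := by
  obtain ⟨R', hR', hR⟩ := hR
  refine ⟨_, hR'.exists_le, fun s a ha => exists_congr fun b => and_congr_right fun hb => ?_⟩
  refine hR s (a, b) fun i => ?_
  change Function.update (pos a) (depth α) b i ≤ _
  rw [Function.update_apply]
  split_ifs
  · exact hb
  · exact ha i

theorem exists_lt (hx : DefinableVar x) (hlt : Definable (S := S) fun _ (p : α × ℕ) => p.2 < x p.1)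
    (hR : Definable fun s (p : α × ℕ) => R s p.1 p.2) :
    Definable fun s a => ∃ b < x a, R s a b :=
  (exists_le (R := fun s a b => b < x a ∧ R s a b) (hlt.and hR)).congr fun s a ha => by
    have := hx.le ha
    constructor
    · rintro ⟨b, _, h, h'⟩
      exact ⟨b, h, h'⟩
    · rintro ⟨b, h, h'⟩
      exact ⟨b, by omega, h, h'⟩

theorem eq_var (hf : DefinableTerm f) (hx : DefinableVar x) :
    Definable (S := S) fun _ a => f a = x a := by
  obtain ⟨t, ht, hf⟩ := hf
  obtain ⟨i, hi, hx⟩ := hx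
  exact ⟨_, t.headDecidable_val_eq _ i ht hi, fun s a _ => by rw [hf, hx]⟩

theorem subst (hf : DefinableTerm f) (hR : Definable fun s (p : α × ℕ) => R s p.1 p.2) :
    Definable fun s a => f a ≤ s.length ∧ R s a (f a) := by
  refine (exists_le (R := fun s a b => f a = b ∧ R s a b)
    ((eq_var hf.fst DefinableVar.snd).and hR)).congr fun s a _ => ?_
  constructor
  · rintro ⟨b, h, rfl, h'⟩
    exact ⟨h, h'⟩
  · rintro ⟨h, h'⟩
    exact ⟨_, h, rfl, h'⟩

theorem var_lt (hx : DefinableVar x) (hy : DefinableVar y) :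
    Definable (S := S) fun _ a => x a < y a := by
  obtain ⟨i, hi, hx⟩ := hx
  obtain ⟨j, hj, hy⟩ := hy
  exact ⟨_, (HeadDecidable.le hj hi).not, fun s a _ => by rw [hx, hy, not_le]⟩

theorem lt_var (hf : DefinableTerm f) (hx : DefinableVar x) :
    Definable (S := S) fun _ a => f a < x a :=
  (subst (R := fun _ a b => b < x a) hf (var_lt DefinableVar.snd hx.fst)).congr fun s a ha => by
    have := hx.le ha
    constructor
    · exact fun h => h.2
    · exact fun h => ⟨by omega, h⟩

theorem exists_lt_var (hx : DefinableVar x) (hR : Definable fun s (p : α × ℕ) => R s p.1 p.2) :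
    Definable fun s a => ∃ b < x a, R s a b :=
  exists_lt hx (var_lt DefinableVar.snd hx.fst) hR

theorem forall_lt_var (hx : DefinableVar x) (hR : Definable fun s (p : α × ℕ) => R s p.1 p.2) :
    Definable fun s a => ∀ b < x a, R s a b :=
  (exists_lt_var (R := fun s a b => ¬ R s a b) hx hR.not).not.congr fun s a _ => by
    simp only [not_exists, not_and, not_not]

theorem read (hf : DefinableTerm f) (c : S) : Definable fun s a => s[f a]? = some c := by
  refine (subst (R := fun s _ b => s[b]? = some c) hf ?_).congr fun s a _ => ?_
  · exact ⟨_, HeadDecidable.read (i := depth α) c, fun s p _ => by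
      change s[Function.update (pos p.1) (depth α) p.2 (depth α)]? = _ ↔ _
      rw [Function.update_self]⟩
  -- The bound on `f a` demanded by `subst` is automatic: no symbol can be read beyond the end.
  · refine ⟨fun h => h.2, fun h => ⟨?_, h⟩⟩
    obtain ⟨h, _⟩ := List.getElem?_eq_some_iff.1 h
    exact h.le

end Definable

theorem Definable.nonempty_tm2ComputableInPolyTime {S : Type} [Inhabited S] [DecidableEq S]
    [Fintype S] {P : List S → Prop} (hP : Definable fun s (_ : Unit) => P s) {α : Type}
    (ea : α → List S) (f : α → Bool) (hf : ∀ a, f a = true ↔ P (ea a)) :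
    Nonempty (Turing.TM2ComputableInPolyTime ea Computability.encodeBool f) := by
  obtain ⟨Q, ⟨p, hp⟩, hQ⟩ := hP
  refine HeadProg.nonempty_tm2ComputableInPolyTime ea f p fun a => ?_
  obtain ⟨b, hb, hr⟩ := hp (ea a) (fun _ => 0) (fun _ => Nat.zero_le _) (fun _ _ => rfl)
  have : b = f a := by
    rw [Bool.eq_iff_iff, hb, hf]
    exact hQ (ea a) () fun _ => Nat.zero_le _
  exact this ▸ hr

/-! ### The formula of the hard language -/

/-- The bits `M i` describe a circuit on the wires `0, …, q - 1` of which the wires below `n` are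
inputs: the wire `g` computes the disjunction of the earlier wires `h` with `M (g * q + h)`, where
the inputs of the disjunction are negated if `M (g * q + g + 1)` and its output is negated if
`M (g * q + g)`. `IsTranscript M q n inp val` says that `val` are the values of the wires on the
input `inp`. -/
def IsTranscript (M : ℕ → Prop) (q n : ℕ) (inp val : ℕ → Prop) : Prop :=
  ∀ g < q, (g < n → (val g ↔ inp g)) ∧
    (¬ g < n → (val g ↔ ¬ (M (g * q + g) ↔
      ∃ h < g, M (g * q + h) ∧ ¬ (val h ↔ M (g * q + g + 1)))))

/-- The lexicographic order of strings of length `m`. -/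
def LexLT (m : ℕ) (f g : ℕ → Prop) : Prop :=
  ∃ i < m, ¬ f i ∧ g i ∧ ∀ j < i, (f j ↔ g j)

/-- The rows `B 0, …, B (t - 1)` are the binary expansions of `0, …, t - 1` to `n` digits. -/
def IsBinaryTable (t n : ℕ) (B : ℕ → ℕ → Prop) : Prop :=
  (∀ g < n, ¬ B 0 g) ∧
    ∀ u < t, u + 1 < t → ∀ g < n, (B (u + 1) g ↔ ¬ (B u g ↔ ∀ h < g, B u h))

/-- `val` consists of the values of the wires of the circuit `M` on the rows of `B`, and `T` lists
the values of the wire `o`. -/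
def HasTable (M : ℕ → Prop) (q n t o : ℕ) (B val : ℕ → ℕ → Prop) (T : ℕ → Prop) : Prop :=
  (∀ u < t, IsTranscript M q n (B u) (val u)) ∧ ∀ u < t, (val u o ↔ T u)

/-- The string of length `l` that asks for the bit `i` of the first circuit with table `T`. -/
def queryBit (t l : ℕ) (T : ℕ → Prop) (i g : ℕ) : Prop :=
  (g < t ∧ T g) ∨ t + i = g ∨ g + 1 = l

/-- `X` is accepted by the table `T`, which is the first one without a circuit, where the circuit
`D` finds circuits for the smaller tables. -/
def HardFormula (n q r t l Q o O : ℕ) (X T D : ℕ → Prop) (B : ℕ → ℕ → Prop)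
    (M : ℕ → Prop) (val : ℕ → ℕ → Prop) (T' : ℕ → Prop) (val' : ℕ → ℕ → Prop) : Prop :=
  IsBinaryTable t n B ∧ (∃ u < t, T u ∧ ∀ g < n, (X g ↔ B u g)) ∧
    ¬ HasTable M q n t o B val T ∧
    (LexLT t T' T → (∀ u < t, IsTranscript M q n (B u) (val u)) →
      (∀ i < r, IsTranscript D Q l (queryBit t l T' i) (val' i) ∧ (M i ↔ val' i O)) →
      HasTable M q n t o B val T')

/-- `M` is the first circuit with the table given by `X`, and its bit asked for by `X` is `1`. -/
def FirstCircuitFormula (n q r t o : ℕ) (X M : ℕ → Prop) (val B : ℕ → ℕ → Prop)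
    (M' : ℕ → Prop) (val' : ℕ → ℕ → Prop) : Prop :=
  IsBinaryTable t n B ∧ HasTable M q n t o B val X ∧ (∃ i < r, X (t + i) ∧ M i) ∧
    (LexLT r M' M → ¬ HasTable M' q n t o B val' X)

/-- The entry `(i, j)` of the matrix with index `a` in a string of matrices of width `W`. -/
def matrixBit (A : ℕ → Prop) (W a i j : ℕ) : Prop := A ((a * W + i) * W + j)

/-- The relations between the parameters. -/
def ParamRel (K n q r t l Q o O W : ℕ) : Prop :=
  n ^ K = q ∧ q * q + 1 = r ∧ n ^ (3 * K) = t ∧ n ^ (4 * K) = l ∧ n ^ (4 * K * K) = Q ∧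
    o + 1 = q ∧ O + 1 = Q ∧ n ^ (8 * K * K + 1) = W

/-- The matrix of the hard language on inputs `X` of length `m`; all numbers are at most `N`. -/
def HardMatrix (K N m : ℕ) (X Y Z : ℕ → Prop) : Prop :=
  ∃ e ≤ N, ∃ n ≤ N, ∃ q ≤ N, ∃ r ≤ N, ∃ t ≤ N, ∃ l ≤ N, ∃ Q ≤ N, ∃ o ≤ N, ∃ O ≤ N, ∃ W ≤ N,
    e + 1 = m ∧ ParamRel K n q r t l Q o O W ∧
    ((¬ X e ∧ n = m ∧ HardFormula n q r t l Q o O X (matrixBit Y W 0 0) (matrixBit Y W 1 0)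
        (matrixBit Y W 2) (matrixBit Z W 0 0) (matrixBit Z W 1) (matrixBit Z W 2 0)
        (matrixBit Z W 3)) ∨
      (X e ∧ l = m ∧ FirstCircuitFormula n q r t o X (matrixBit Y W 0 0) (matrixBit Y W 1)
        (matrixBit Y W 2) (matrixBit Z W 0 0) (matrixBit Z W 1)))

/-- The bits of the string between the positions `b` and `e`. -/
def segmentBit (s : List (Option Bool)) (b e i : ℕ) : Prop :=
  b + i < e ∧ s[b + i]? = some (some true)

/-- The bits of the string from the position `b` on. -/
def tailBit (s : List (Option Bool)) (b i : ℕ) : Prop := s[b + i]? = some (some true)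

/-- The matrix of the hard language as a predicate of the encoded triple. -/
def HardPredicate (K : ℕ) (s : List (Option Bool)) : Prop :=
  ∃ m ≤ s.length, ∃ m' ≤ s.length, m < m' ∧ s[m]? = some none ∧ s[m']? = some none ∧
    HardMatrix K s.length m (segmentBit s 0 m) (segmentBit s (m + 1) m') (tailBit s (m' + 1))

-- Every quantifier in the formula is bounded by a variable or by the length of the string, and
-- every atom is a read, an equation or an inequality between a term and a variable, so the closure
-- properties apply along the syntax. The chains of `fst` are de Bruijn indices of variables.
set_option maxHeartbeats 4000000 in
set_option linter.unusedTactic false in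
set_option linter.unreachableTactic false in
theorem definable_hardPredicate (K : ℕ) :
    Definable fun s (_ : Unit) => HardPredicate K s := by
  unfold HardPredicate HardMatrix ParamRel HardFormula FirstCircuitFormula HasTable IsBinaryTable
    LexLT queryBit IsTranscript matrixBit segmentBit tailBit
  dsimp only
  repeat' first
    | with_reducible refine Definable.exists_le ?_
    | with_reducible refine Definable.exists_lt_var ?_ ?_
    | with_reducible refine Definable.forall_lt_var ?_ ?_
    | with_reducible refine Definable.not ?_
    | with_reducible refine Definable.and ?_ ?_
    | with_reducible refine Definable.or ?_ ?_
    | with_reducible refine Definable.iff ?_ ?_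
    | with_reducible refine Definable.imp ?_ ?_
    | with_reducible refine Definable.read ?_ _
    | with_reducible refine Definable.eq_var ?_ ?_
    | with_reducible refine Definable.lt_var ?_ ?_
    | with_reducible refine DefinableTerm.add ?_ ?_
    | with_reducible refine DefinableTerm.mul ?_ ?_
    | with_reducible refine DefinableTerm.pow ?_ _
    | with_reducible exact DefinableTerm.const _
    | with_reducible refine DefinableVar.term ?_
    | with_reducible exact DefinableVar.snd
    | with_reducible exact DefinableVar.snd.fst
    | with_reducible exact DefinableVar.snd.fst.fst
    | with_reducible exact DefinableVar.snd.fst.fst.fst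
    | with_reducible exact DefinableVar.snd.fst.fst.fst.fst
    | with_reducible exact DefinableVar.snd.fst.fst.fst.fst.fst
    | with_reducible exact DefinableVar.snd.fst.fst.fst.fst.fst.fst
    | with_reducible exact DefinableVar.snd.fst.fst.fst.fst.fst.fst.fst
    | with_reducible exact DefinableVar.snd.fst.fst.fst.fst.fst.fst.fst.fst
    | with_reducible exact DefinableVar.snd.fst.fst.fst.fst.fst.fst.fst.fst.fst
    | with_reducible exact DefinableVar.snd.fst.fst.fst.fst.fst.fst.fst.fst.fst.fst
    | with_reducible exact DefinableVar.snd.fst.fst.fst.fst.fst.fst.fst.fst.fst.fst.fst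
    | with_reducible exact DefinableVar.snd.fst.fst.fst.fst.fst.fst.fst.fst.fst.fst.fst.fst
    | with_reducible exact DefinableVar.snd.fst.fst.fst.fst.fst.fst.fst.fst.fst.fst.fst.fst.fst
    | with_reducible exact DefinableVar.snd.fst.fst.fst.fst.fst.fst.fst.fst.fst.fst.fst.fst.fst.fst
    | with_reducible exact DefinableVar.snd.fst.fst.fst.fst.fst.fst.fst.fst.fst.fst.fst.fst.fst.fst.fst
    | with_reducible exact DefinableVar.snd.fst.fst.fst.fst.fst.fst.fst.fst.fst.fst.fst.fst.fst.fst.fst.fst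

/-! ### Circuits given by strings -/

/-- The values of the wires of the circuit `M`. -/
def circuitValue (M : ℕ → Prop) (q n : ℕ) (inp : ℕ → Prop) (g : ℕ) : Prop :=
  (g < n ∧ inp g) ∨ (¬ g < n ∧ ¬ (M (g * q + g) ↔
    ∃ h, ∃ _ : h < g, M (g * q + h) ∧ ¬ (circuitValue M q n inp h ↔ M (g * q + g + 1))))
termination_by g

theorem isTranscript_circuitValue (M : ℕ → Prop) (q n : ℕ) (inp : ℕ → Prop) :
    IsTranscript M q n inp (circuitValue M q n inp) := by
  intro g _
  constructor
  · intro h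
    rw [circuitValue]
    simp [h]
  · intro h
    rw [circuitValue]
    simp only [h, false_and, false_or, not_false_eq_true, true_and, exists_prop]

/-- Row `g` uses the offsets up to `g + 1`, so the last row reaches the index `q * q`; hence a
circuit has `q * q + 1` bits. -/
theorem wire_index_lt {q g h : ℕ} (hg : g < q) (hh : h ≤ q) : g * q + h < q * q + 1 := by
  have : (g + 1) * q ≤ q * q := Nat.mul_le_mul_right q hg
  rw [Nat.succ_mul] at this
  omega

/-- A wire depends only on earlier wires, so strong induction applies. Together with
`isTranscript_circuitValue` this lets transcripts be quantified either way. -/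
theorem IsTranscript.unique {M M' : ℕ → Prop} {q n : ℕ} {inp inp' val val' : ℕ → Prop}
    (hM : ∀ i < q * q + 1, (M i ↔ M' i)) (hinp : ∀ g < n, (inp g ↔ inp' g))
    (h : IsTranscript M q n inp val) (h' : IsTranscript M' q n inp' val') :
    ∀ g < q, (val g ↔ val' g) := by
  intro g
  induction g using Nat.strong_induction_on with
  | _ g ih =>
    intro hg
    by_cases hn : g < n
    · rw [(h g hg).1 hn, (h' g hg).1 hn, hinp g hn]
    · rw [(h g hg).2 hn, (h' g hg).2 hn, hM _ (wire_index_lt hg hg.le)]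
      refine not_congr (iff_congr Iff.rfl (exists_congr fun k => and_congr_right fun hk => ?_))
      rw [hM _ (wire_index_lt hg (hk.trans hg).le), ih k hk (hk.trans hg),
        add_assoc, hM _ (wire_index_lt hg hg)]

theorem IsTranscript.congr {M M' : ℕ → Prop} {q n : ℕ} {inp inp' val val' : ℕ → Prop}
    (hM : ∀ i < q * q + 1, (M i ↔ M' i)) (hinp : ∀ g < n, (inp g ↔ inp' g))
    (hval : ∀ g < q, (val g ↔ val' g)) (h : IsTranscript M q n inp val) :
    IsTranscript M' q n inp' val' := by
  intro g hg
  constructor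
  · intro hn
    rw [← hval g hg, (h g hg).1 hn, hinp g hn]
  · intro hn
    rw [← hval g hg, (h g hg).2 hn, hM _ (wire_index_lt hg hg.le)]
    refine not_congr (iff_congr Iff.rfl (exists_congr fun k => and_congr_right fun hk => ?_))
    rw [hM _ (wire_index_lt hg (hk.trans hg).le), hval k (hk.trans hg),
      add_assoc, hM _ (wire_index_lt hg hg)]

theorem wire_index_injective {q g g' a b : ℕ} (hg : g < q) (hg' : g' < q) (ha : a ≤ g + 1)
    (hb : b ≤ g' + 1) (h : g * q + a = g' * q + b) : g = g' ∧ a = b := by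
  rcases lt_trichotomy g g' with hlt | rfl | hlt
  · have : (g + 1) * q ≤ g' * q := Nat.mul_le_mul_right q hlt
    rw [Nat.succ_mul] at this
    omega
  · exact ⟨rfl, by omega⟩
  · have : (g' + 1) * q ≤ g * q := Nat.mul_le_mul_right q hlt
    rw [Nat.succ_mul] at this
    omega

theorem exists_circuit_bits (q : ℕ) (adj : ℕ → ℕ → Prop) (c d : ℕ → Prop) :
    ∃ M : ℕ → Prop, ∀ g < q, (M (g * q + g) ↔ c g) ∧ (M (g * q + g + 1) ↔ d g) ∧
      ∀ h < g, (M (g * q + h) ↔ adj g h) := by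
  refine ⟨fun i => ∃ g < q, ∃ a ≤ g + 1, i = g * q + a ∧
    ((a = g ∧ c g) ∨ (a = g + 1 ∧ d g) ∨ (a < g ∧ adj g a)), fun g hg => ?_⟩
  have key : ∀ b ≤ g + 1, (∃ g' < q, ∃ a ≤ g' + 1, g * q + b = g' * q + a ∧
      ((a = g' ∧ c g') ∨ (a = g' + 1 ∧ d g') ∨ (a < g' ∧ adj g' a))) ↔
      ((b = g ∧ c g) ∨ (b = g + 1 ∧ d g) ∨ (b < g ∧ adj g b)) := by
    intro b hb
    constructor
    · rintro ⟨g', hg', a, ha, h, h'⟩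
      obtain ⟨rfl, rfl⟩ := wire_index_injective hg hg' hb ha h
      exact h'
    · exact fun h => ⟨g, hg, b, hb, rfl, h⟩
  refine ⟨(key g (by omega)).trans ?_, (key (g + 1) le_rfl).trans ?_,
    fun h hh => (key h (by omega)).trans ?_⟩
  · simp
  · simp
  · simp [hh, hh.ne, (Nat.lt_succ_of_lt hh).ne]

/-- Translation of lists of gates. -/
theorem GateList.exists_bits {n s : ℕ} (G : GateList n s) :
    ∃ (adj : ℕ → ℕ → Prop) (c d : ℕ → Prop), ∀ (x : Fin n → Bool) (val : ℕ → Prop),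
      (∀ i : Fin n, (val i ↔ x i = true)) →
      (∀ g, n ≤ g → g < n + s → (val g ↔ ¬ (c g ↔ ∃ h < g, adj g h ∧ ¬ (val h ↔ d g)))) →
      ∀ i : Fin (n + s), (val i ↔ G.wires x i = true) := by
  induction G with
  | nil => exact ⟨fun _ _ => False, fun _ => False, fun _ => False, fun x val hx _ i => hx i⟩
  | @snoc s G gate ih =>
    obtain ⟨adj, c, d, ih⟩ := ih
    -- Every gate is a disjunction with optional negations: a constant is an empty disjunction with
    -- its output negated if the constant is true, a negation has one input and negated output, a
    -- conjunction is obtained by De Morgan.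
    obtain ⟨a, c', d', hgate⟩ : ∃ (a : ℕ → Prop) (c' d' : Prop), ∀ (v : Fin (n + s) → Bool)
        (val : ℕ → Prop), (∀ i : Fin (n + s), (val i ↔ v i = true)) →
        ((¬ (c' ↔ ∃ h < n + s, a h ∧ ¬ (val h ↔ d'))) ↔ gate.eval v = true) := by
      rcases gate with b | i | ⟨i, j⟩ | ⟨i, j⟩
      · exact ⟨fun _ => False, b = true, False, fun v val _ => by simp [CircuitGate.eval]⟩
      · refine ⟨fun h => h = i, True, False, fun v val hv => ?_⟩
        simp [CircuitGate.eval, hv]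
      · refine ⟨fun h => h = i ∨ h = j, True, True, fun v val hv => ?_⟩
        simp only [CircuitGate.eval, Bool.and_eq_true, ← hv]
        constructor
        · intro h
          by_contra h'
          refine h ⟨fun _ => ?_, fun _ => trivial⟩
          by_cases hi : val i
          · exact ⟨j, j.2, Or.inr rfl, fun h'' => h' ⟨hi, h''.2 trivial⟩⟩
          · exact ⟨i, i.2, Or.inl rfl, fun h'' => hi (h''.2 trivial)⟩
        · rintro ⟨hi, hj⟩ h
          obtain ⟨k, _, rfl | rfl, h'⟩ := h.1 trivial
          · exact h' ⟨fun _ => trivial, fun _ => hi⟩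
          · exact h' ⟨fun _ => trivial, fun _ => hj⟩
      · refine ⟨fun h => h = i ∨ h = j, False, False, fun v val hv => ?_⟩
        simp only [CircuitGate.eval, Bool.or_eq_true, ← hv]
        constructor
        · intro h
          by_contra h'
          refine h ⟨False.elim, ?_⟩
          rintro ⟨k, _, rfl | rfl, hk⟩
          · exact hk ⟨fun h'' => h' (Or.inl h''), False.elim⟩
          · exact hk ⟨fun h'' => h' (Or.inr h''), False.elim⟩
        · rintro (hi | hi) h
          · exact h.2 ⟨i, i.2, Or.inl rfl, fun h' => h'.1 hi⟩
          · exact h.2 ⟨j, j.2, Or.inr rfl, fun h' => h'.1 hi⟩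
    refine ⟨fun g => if g = n + s then a else adj g, fun g => if g = n + s then c' else c g,
      fun g => if g = n + s then d' else d g, fun x val hx hg => ?_⟩
    have hG := ih x val hx fun g h₁ h₂ => by
      have := hg g h₁ (by omega)
      dsimp only at this
      rwa [if_neg (by omega), if_neg (by omega), if_neg (by omega)] at this
    intro i
    refine Fin.lastCases ?_ (fun i => ?_) i
    · have := hg (n + s) (by omega) (by omega)
      dsimp only at this
      rw [if_pos rfl, if_pos rfl, if_pos rfl] at this
      refine (this.trans (hgate _ val hG)).trans ?_
      simp [GateList.wires]
    · refine (hG i).trans ?_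
      have : G.wires x i = (G.snoc gate).wires x i.castSucc := by
        simp only [GateList.wires]
        exact (Fin.snoc_castSucc (α := fun _ => Bool) _ _ _).symm
      rw [this]

/-- Translation of circuits. -/
theorem BoolCircuit.exists_bits {n q : ℕ} (C : BoolCircuit n) (hq : n + C.size < q) :
    ∃ M : ℕ → Prop, ∀ (x : Fin n → Bool) (inp val : ℕ → Prop) (o : ℕ), o + 1 = q →
      (∀ i : Fin n, (inp i ↔ x i = true)) → IsTranscript M q n inp val →
      (val o ↔ C.eval x = true) := by
  obtain ⟨adj, c, d, h⟩ := C.gates.exists_bits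
  -- The last wire copies the output wire of `C`, so that the output has a fixed place; `hq` leaves
  -- room for it. Wires between the gates of `C` and the last wire play no role.
  obtain ⟨M, hM⟩ := exists_circuit_bits q
    (fun g => if g + 1 = q then fun h => h = C.out else adj g)
    (fun g => if g + 1 = q then False else c g) (fun g => if g + 1 = q then False else d g)
  refine ⟨M, fun x inp val o ho hinp hval => ?_⟩
  have hwire := h x val
    (fun i => ((hval i (by omega)).1 i.2).trans (hinp i))
    (fun g h₁ h₂ => by
      obtain ⟨m₁, m₂, m₃⟩ := hM g (by omega)
      rw [if_neg (by omega)] at m₁ m₂ m₃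
      rw [(hval g (by omega)).2 (by omega), m₁, m₂]
      refine not_congr (iff_congr Iff.rfl (exists_congr fun k => and_congr_right fun hk => ?_))
      rw [m₃ k hk]) C.out
  obtain ⟨m₁, m₂, m₃⟩ := hM o (by omega)
  rw [if_pos ho] at m₁ m₂ m₃
  have hout : (C.out : ℕ) < o := by have := C.out.2; omega
  rw [(hval o (by omega)).2 (by omega), m₁, m₂, BoolCircuit.eval, ← hwire]
  constructor
  · intro h
    by_contra h'
    refine h ⟨False.elim, ?_⟩
    rintro ⟨k, hk, hk', hk''⟩
    rw [m₃ k hk] at hk'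
    subst hk'
    exact hk'' ⟨h', False.elim⟩
  · intro h h'
    exact h'.2 ⟨C.out, hout, (m₃ _ hout).2 rfl, fun h'' => h''.1 h⟩

/-! ### The lexicographic order -/

open Classical in
/-- The number with the binary digits `f 0, …, f (m - 1)`. -/
noncomputable def lexCode (f : ℕ → Prop) : ℕ → ℕ
  | 0 => 0
  | m + 1 => 2 * lexCode f m + if f m then 1 else 0

theorem lexCode_congr {f g : ℕ → Prop} {m : ℕ} (h : ∀ i < m, (f i ↔ g i)) :
    lexCode f m = lexCode g m := by
  induction m with
  | zero => rfl
  | succ m ih =>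
    rw [lexCode, lexCode, ih fun i hi => h i (by omega), propext (h m (by omega))]

theorem LexLT.lexCode_lt {f g : ℕ → Prop} {m : ℕ} (h : LexLT m f g) :
    lexCode f m < lexCode g m := by
  induction m with
  | zero => obtain ⟨i, hi, _⟩ := h; omega
  | succ m ih =>
    obtain ⟨i, hi, hf, hg, hj⟩ := h
    simp only [lexCode]
    by_cases him : i = m
    · subst him
      rw [lexCode_congr hj, if_neg hf, if_pos hg]
      omega
    · have := ih ⟨i, by omega, hf, hg, hj⟩
      split_ifs <;> omega

theorem exists_lexLT_minimal (m : ℕ) {P : (ℕ → Prop) → Prop} (h : ∃ f, P f) :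
    ∃ f, P f ∧ ∀ g, LexLT m g f → ¬ P g := by
  obtain ⟨f, hf, hmin⟩ := WellFounded.has_min (measure fun f => lexCode f m).wf {f | P f} h
  exact ⟨f, hf, fun g hg hP => hmin g hP hg.lexCode_lt⟩

theorem LexLT.trichotomy {m : ℕ} {f g : ℕ → Prop} (h₁ : ¬ LexLT m f g) (h₂ : ¬ LexLT m g f) :
    ∀ i < m, (f i ↔ g i) := by
  intro i
  induction i using Nat.strong_induction_on with
  | _ i ih =>
    intro hi
    have hj : ∀ j < i, (f j ↔ g j) := fun j hj => ih j hj (by omega)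
    by_cases hf : f i <;> by_cases hg : g i
    · simp [hf, hg]
    · exact absurd ⟨i, hi, hg, hf, fun j h => (hj j h).symm⟩ h₂
    · exact absurd ⟨i, hi, hf, hg, hj⟩ h₁
    · simp [hf, hg]

theorem LexLT.congr {m : ℕ} {f f' g g' : ℕ → Prop} (hf : ∀ i < m, (f i ↔ f' i))
    (hg : ∀ i < m, (g i ↔ g' i)) (h : LexLT m f g) : LexLT m f' g' := by
  obtain ⟨i, hi, h₁, h₂, h₃⟩ := h
  exact ⟨i, hi, by rwa [← hf i hi], by rwa [← hg i hi],
    fun j hj => by rw [← hf j (by omega), ← hg j (by omega), h₃ j hj]⟩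

/-! ### Binary expansions -/

/-- Adding one flips the digit `g` precisely when a carry arrives, that is, when all lower digits
are one. -/
theorem testBit_succ_iff (u g : ℕ) : (u + 1).testBit g = true ↔
    ¬ (u.testBit g = true ↔ ∀ h < g, u.testBit h = true) := by
  induction g generalizing u with
  | zero =>
    simp only [Nat.testBit_zero, decide_eq_true_eq, Nat.not_lt_zero, false_imp_iff, implies_true,
      iff_true]
    omega
  | succ g ih =>
    have hall : (∀ h < g + 1, u.testBit h = true) ↔
        (u % 2 = 1 ∧ ∀ h < g, (u / 2).testBit h = true) := by
      constructor
      · intro h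
        refine ⟨by simpa using h 0 (by omega), fun k hk => ?_⟩
        rw [← Nat.testBit_succ]
        exact h (k + 1) (by omega)
      · rintro ⟨h₁, h₂⟩ k hk
        cases k with
        | zero => simpa using h₁
        | succ k => rw [Nat.testBit_succ]; exact h₂ k (by omega)
    rw [Nat.testBit_succ, Nat.testBit_succ, hall]
    rcases Nat.mod_two_eq_zero_or_one u with h | h
    · rw [show (u + 1) / 2 = u / 2 by omega]
      simp [h]
    · rw [show (u + 1) / 2 = u / 2 + 1 by omega, ih]
      simp [h]

theorem isBinaryTable_testBit (t n : ℕ) : IsBinaryTable t n fun u g => u.testBit g = true :=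
  ⟨fun g _ => by simp, fun u _ _ g _ => testBit_succ_iff u g⟩

theorem IsBinaryTable.iff_testBit {t n : ℕ} {B : ℕ → ℕ → Prop} (hB : IsBinaryTable t n B) :
    ∀ u < t, ∀ g < n, (B u g ↔ u.testBit g = true) := by
  intro u
  induction u with
  | zero => intro _ g hg; simpa using hB.1 g hg
  | succ u ih =>
    intro hu g hg
    rw [hB.2 u (by omega) hu g hg, testBit_succ_iff, ih (by omega) g hg]
    refine not_congr (iff_congr Iff.rfl (forall_congr' fun k => imp_congr_right fun hk => ?_))
    exact ih (by omega) k (by omega)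

theorem IsBinaryTable.congr {t n : ℕ} {B B' : ℕ → ℕ → Prop} (ht : 0 < t)
    (h : ∀ u < t, ∀ g < n, (B u g ↔ B' u g)) (hB : IsBinaryTable t n B) :
    IsBinaryTable t n B' := by
  refine ⟨fun g hg => by rw [← h 0 ht g hg]; exact hB.1 g hg, fun u hu hu' g hg => ?_⟩
  rw [← h _ hu' g hg, ← h u hu g hg, hB.2 u hu hu' g hg]
  refine not_congr (iff_congr Iff.rfl (forall_congr' fun k => imp_congr_right fun hk => ?_))
  exact h u hu k (by omega)

/-! ### Tables of circuits -/

theorem HasTable.congr {M M' : ℕ → Prop} {q n t o : ℕ} {B B' val val' : ℕ → ℕ → Prop}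
    {T T' : ℕ → Prop} (ho : o < q) (hM : ∀ i < q * q + 1, (M i ↔ M' i))
    (hB : ∀ u < t, ∀ g < n, (B u g ↔ B' u g)) (hval : ∀ u < t, ∀ g < q, (val u g ↔ val' u g))
    (hT : ∀ u < t, (T u ↔ T' u)) (h : HasTable M q n t o B val T) :
    HasTable M' q n t o B' val' T' :=
  ⟨fun u hu => (h.1 u hu).congr hM (hB u hu) (hval u hu),
    fun u hu => by rw [← hval u hu o ho, ← hT u hu, h.2 u hu]⟩

/-- Counting: the `q * q + 1` bits of a circuit determine its table, so if all `2 ^ t` tables had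
circuits, then `t ≤ q * q + 1`. -/
theorem exists_table_without_circuit (q n t o : ℕ) (ho : o < q) (hr : q * q + 1 < t)
    (B : ℕ → ℕ → Prop) : ∃ T : ℕ → Prop, ¬ ∃ M val, HasTable M q n t o B val T := by
  by_contra hall
  push Not at hall
  let ext : (Fin t → Bool) → ℕ → Prop := fun T u => ∃ h : u < t, T ⟨u, h⟩ = true
  choose M val hM using fun T : Fin t → Bool => hall (ext T)
  classical
  have hinj : Function.Injective fun (T : Fin t → Bool) (i : Fin (q * q + 1)) =>
      decide (M T i) := by
    intro T T' h
    funext u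
    have hval := IsTranscript.unique (M := M T) (M' := M T')
      (fun i hi => decide_eq_decide.1 (congrFun h ⟨i, hi⟩)) (fun _ _ => Iff.rfl)
      ((hM T).1 u u.2) ((hM T').1 u u.2) o ho
    rw [(hM T).2 u u.2, (hM T').2 u u.2] at hval
    rw [Bool.eq_iff_iff]
    exact ⟨fun h => (hval.1 ⟨u.2, h⟩).2, fun h => (hval.2 ⟨u.2, h⟩).2⟩
  have := Fintype.card_le_of_injective _ hinj
  simp only [Fintype.card_fun, Fintype.card_bool, Fintype.card_fin] at this
  have := (Nat.pow_le_pow_iff_right (by norm_num : 1 < 2)).1 this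
  omega

/-! ### The hard language -/

/-- The bits of a string. -/
def bitAt (x : List Bool) (i : ℕ) : Prop := x[i]? = some true

/-! ### Reading the components of an encoded triple -/

theorem length_encodeTriple (x y z : List Bool) :
    (encodeTriple (x, y, z)).length = x.length + y.length + z.length + 2 := by
  simp [encodeTriple]
  omega

theorem getElem?_encodeTriple_fst (x y z : List Bool) (i : ℕ) (hi : i < x.length) :
    (encodeTriple (x, y, z))[i]? = x[i]?.map some := by
  simp [encodeTriple, List.getElem?_append_left, hi]

theorem getElem?_encodeTriple_sep₁ (x y z : List Bool) :
    (encodeTriple (x, y, z))[x.length]? = some none := by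
  simp [encodeTriple]

theorem getElem?_encodeTriple_snd (x y z : List Bool) (i : ℕ) (hi : i < y.length) :
    (encodeTriple (x, y, z))[x.length + 1 + i]? = y[i]?.map some := by
  rw [encodeTriple, List.getElem?_append_right (by simp; omega)]
  rw [List.length_map, show x.length + 1 + i - x.length = i + 1 by omega, List.getElem?_cons_succ,
    List.getElem?_append_left (by simpa using hi), List.getElem?_map]

theorem getElem?_encodeTriple_sep₂ (x y z : List Bool) :
    (encodeTriple (x, y, z))[x.length + 1 + y.length]? = some none := by
  rw [encodeTriple, List.getElem?_append_right (by simp; omega)]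
  rw [List.length_map, show x.length + 1 + y.length - x.length = y.length + 1 by omega,
    List.getElem?_cons_succ, List.getElem?_append_right (by simp)]
  simp

theorem getElem?_encodeTriple_thd (x y z : List Bool) (i : ℕ) :
    (encodeTriple (x, y, z))[x.length + 1 + y.length + 1 + i]? = z[i]?.map some := by
  rw [encodeTriple, List.getElem?_append_right (by simp; omega)]
  rw [List.length_map, show x.length + 1 + y.length + 1 + i - x.length = y.length + 1 + i + 1 by
    omega, List.getElem?_cons_succ, List.getElem?_append_right (by simp; omega), List.length_map,
    show y.length + 1 + i - y.length = i + 1 by omega, List.getElem?_cons_succ, List.getElem?_map]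

theorem getElem?_encodeTriple_eq_none_iff (x y z : List Bool) (i : ℕ) :
    (encodeTriple (x, y, z))[i]? = some none ↔ i = x.length ∨ i = x.length + 1 + y.length := by
  constructor
  · intro h
    by_contra hi
    push Not at hi
    rcases lt_or_ge i x.length with h₁ | h₁
    · rw [getElem?_encodeTriple_fst _ _ _ _ h₁] at h
      simp at h
    rcases lt_or_ge i (x.length + 1 + y.length) with h₂ | h₂
    · obtain ⟨j, rfl⟩ : ∃ j, i = x.length + 1 + j := ⟨i - (x.length + 1), by omega⟩
      rw [getElem?_encodeTriple_snd _ _ _ _ (by omega)] at h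
      simp at h
    · obtain ⟨j, rfl⟩ : ∃ j, i = x.length + 1 + y.length + 1 + j :=
        ⟨i - (x.length + 1 + y.length + 1), by omega⟩
      rw [getElem?_encodeTriple_thd] at h
      simp at h
  · rintro (rfl | rfl)
    · exact getElem?_encodeTriple_sep₁ x y z
    · exact getElem?_encodeTriple_sep₂ x y z

theorem segmentBit_encodeTriple_fst (x y z : List Bool) :
    segmentBit (encodeTriple (x, y, z)) 0 x.length = bitAt x := by
  funext i
  rw [segmentBit, bitAt, Nat.zero_add]
  refine propext ⟨fun h => ?_, fun h => ?_⟩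
  · have := h.2
    rw [getElem?_encodeTriple_fst _ _ _ _ h.1] at this
    simpa using this
  · obtain ⟨hi, _⟩ := List.getElem?_eq_some_iff.1 h
    exact ⟨hi, by rw [getElem?_encodeTriple_fst _ _ _ _ hi, h]; rfl⟩

theorem segmentBit_encodeTriple_snd (x y z : List Bool) :
    segmentBit (encodeTriple (x, y, z)) (x.length + 1) (x.length + 1 + y.length) = bitAt y := by
  funext i
  rw [segmentBit, bitAt]
  refine propext ⟨fun h => ?_, fun h => ?_⟩
  · have := h.2
    rw [getElem?_encodeTriple_snd _ _ _ _ (by omega)] at this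
    simpa using this
  · obtain ⟨hi, _⟩ := List.getElem?_eq_some_iff.1 h
    exact ⟨by omega, by rw [getElem?_encodeTriple_snd _ _ _ _ hi, h]; rfl⟩

theorem tailBit_encodeTriple (x y z : List Bool) :
    tailBit (encodeTriple (x, y, z)) (x.length + 1 + y.length + 1) = bitAt z := by
  funext i
  rw [tailBit, bitAt, getElem?_encodeTriple_thd]
  simp

/-- An encoded triple has exactly two separators, so the positions guessed by the predicate are
forced. -/
theorem hardPredicate_encodeTriple (K : ℕ) (x y z : List Bool) :
    HardPredicate K (encodeTriple (x, y, z)) ↔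
      HardMatrix K (x.length + y.length + z.length + 2) x.length (bitAt x) (bitAt y) (bitAt z) := by
  rw [← length_encodeTriple, ← segmentBit_encodeTriple_fst x y z,
    ← segmentBit_encodeTriple_snd x y z, ← tailBit_encodeTriple x y z]
  constructor
  · rintro ⟨m, _, m', _, hlt, hm, hm', h⟩
    rw [getElem?_encodeTriple_eq_none_iff] at hm hm'
    obtain rfl : m = x.length := by omega
    obtain rfl : m' = x.length + 1 + y.length := by omega
    exact h
  · intro h
    exact ⟨_, by rw [length_encodeTriple]; omega, _, by rw [length_encodeTriple]; omega, by omega,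
      getElem?_encodeTriple_sep₁ x y z, getElem?_encodeTriple_sep₂ x y z, h⟩

/-! ### The language and its membership in Σ₂ᵖ -/

/-- Strings with prescribed matrices of bits. -/
theorem exists_string_matrixBit (W : ℕ) (F : ℕ → ℕ → ℕ → Prop) :
    ∃ y : List Bool, y.length = 4 * W * W ∧
      ∀ a < 4, ∀ i < W, ∀ j < W, (matrixBit (bitAt y) W a i j ↔ F a i j) := by
  classical
  refine ⟨List.ofFn fun p : Fin (4 * W * W) =>
    decide (F ((p : ℕ) / W / W) ((p : ℕ) / W % W) ((p : ℕ) % W)), by simp, fun a ha i hi j hj => ?_⟩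
  have hlt : (a * W + i) * W + j < 4 * W * W := by
    have h₁ : (a + 1) * W ≤ 4 * W := Nat.mul_le_mul_right W ha
    rw [Nat.succ_mul] at h₁
    have h₂ : (a * W + i + 1) * W ≤ 4 * W * W := Nat.mul_le_mul_right W (by omega)
    rw [Nat.succ_mul] at h₂
    omega
  have h₁ : ((a * W + i) * W + j) / W = a * W + i := by
    rw [mul_comm, Nat.mul_add_div (by omega), Nat.div_eq_of_lt hj, add_zero]
  have h₂ : ((a * W + i) * W + j) % W = j := by
    rw [mul_comm, Nat.mul_add_mod, Nat.mod_eq_of_lt hj]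
  have h₃ : (a * W + i) / W = a := by
    rw [mul_comm, Nat.mul_add_div (by omega), Nat.div_eq_of_lt hi, add_zero]
  have h₄ : (a * W + i) % W = i := by
    rw [mul_comm, Nat.mul_add_mod, Nat.mod_eq_of_lt hi]
  rw [matrixBit, bitAt, List.getElem?_ofFn, dif_pos hlt]
  simp [h₁, h₂, h₃, h₄]

/-- The language of the strings `x` for which there is `y` such that the hard predicate holds for
all `z`. -/
def HardLanguage (K : ℕ) : Language Bool :=
  {x | ∃ y : List Bool, y.length ≤ 4 * x.length ^ (2 * (8 * K * K + 1)) ∧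
    ∀ z : List Bool, z.length ≤ 4 * x.length ^ (2 * (8 * K * K + 1)) →
      HardPredicate K (encodeTriple (x, y, z))}

theorem hardLanguage_mem_sigmaTwoP (K : ℕ) : HardLanguage K ∈ SigmaTwoP := by
  classical
  refine ⟨fun x y z => decide (HardPredicate K (encodeTriple (x, y, z))),
    4 * Polynomial.X ^ (2 * (8 * K * K + 1)), ?_, fun x => ?_⟩
  · exact (definable_hardPredicate K).nonempty_tm2ComputableInPolyTime _ _ fun t => by simp
  · change (∃ y : List Bool, _) ↔ _
    simp

/-! ### Dependence of the formulas on bounded parts of the matrices -/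

/-- This is what allows arbitrary predicates in place of `y` and `z`: a string stores only finitely
many of their values. -/
theorem HardFormula.congr {n q r t l Q o O : ℕ} {X T T₂ D D₂ : ℕ → Prop} {B B₂ : ℕ → ℕ → Prop}
    {M M₂ : ℕ → Prop} {val val₂ : ℕ → ℕ → Prop} {T' T₂' : ℕ → Prop} {val' val₂' : ℕ → ℕ → Prop}
    (hr : q * q + 1 = r) (ht : 0 < t) (ho : o < q) (hO : O < Q)
    (hT : ∀ u < t, (T u ↔ T₂ u)) (hD : ∀ i < Q * Q + 1, (D i ↔ D₂ i))
    (hB : ∀ u < t, ∀ g < n, (B u g ↔ B₂ u g)) (hM : ∀ i < r, (M i ↔ M₂ i))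
    (hval : ∀ u < t, ∀ g < q, (val u g ↔ val₂ u g)) (hT' : ∀ u < t, (T' u ↔ T₂' u))
    (hval' : ∀ i < r, ∀ g < Q, (val' i g ↔ val₂' i g))
    (h : HardFormula n q r t l Q o O X T D B M val T' val') :
    HardFormula n q r t l Q o O X T₂ D₂ B₂ M₂ val₂ T₂' val₂' := by
  subst hr
  obtain ⟨h₁, ⟨u, hu, h₂, h₃⟩, h₄, h₅⟩ := h
  have sw : ∀ {P Q : ℕ → Prop} {m : ℕ}, (∀ i < m, (P i ↔ Q i)) → ∀ i < m, (Q i ↔ P i) :=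
    fun h i hi => (h i hi).symm
  have hB' : ∀ u < t, ∀ g < n, (B₂ u g ↔ B u g) := fun u hu => sw (hB u hu)
  have hv' : ∀ u < t, ∀ g < q, (val₂ u g ↔ val u g) := fun u hu => sw (hval u hu)
  refine ⟨h₁.congr ht hB, ⟨u, hu, (hT u hu).1 h₂, fun g hg => (h₃ g hg).trans (hB u hu g hg)⟩,
    fun h => h₄ (h.congr ho (sw hM) hB' hv' (sw hT)), fun hlt htr hD' => ?_⟩
  refine (h₅ (hlt.congr (sw hT') (sw hT))
    (fun u hu => (htr u hu).congr (sw hM) (hB' u hu) (hv' u hu)) fun i hi => ?_).congr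
    ho hM hB hval hT'
  refine ⟨(hD' i hi).1.congr (sw hD) (fun g _ => ?_) (sw (hval' i hi)), ?_⟩
  · refine or_congr (and_congr_right fun hg => (hT' g hg).symm) Iff.rfl
  · rw [hM i hi, hval' i hi O hO]
    exact (hD' i hi).2

theorem FirstCircuitFormula.congr {n q r t o : ℕ} {X M M₂ : ℕ → Prop} {val val₂ B B₂ : ℕ → ℕ → Prop}
    {M' M₂' : ℕ → Prop} {val' val₂' : ℕ → ℕ → Prop} (hr : q * q + 1 = r) (ht : 0 < t) (ho : o < q)
    (hM : ∀ i < r, (M i ↔ M₂ i)) (hval : ∀ u < t, ∀ g < q, (val u g ↔ val₂ u g))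
    (hB : ∀ u < t, ∀ g < n, (B u g ↔ B₂ u g)) (hM' : ∀ i < r, (M' i ↔ M₂' i))
    (hval' : ∀ u < t, ∀ g < q, (val' u g ↔ val₂' u g))
    (h : FirstCircuitFormula n q r t o X M val B M' val') :
    FirstCircuitFormula n q r t o X M₂ val₂ B₂ M₂' val₂' := by
  subst hr
  obtain ⟨h₁, h₂, ⟨i, hi, h₃, h₄⟩, h₅⟩ := h
  have sw : ∀ {P Q : ℕ → Prop} {m : ℕ}, (∀ i < m, (P i ↔ Q i)) → ∀ i < m, (Q i ↔ P i) :=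
    fun h i hi => (h i hi).symm
  exact ⟨h₁.congr ht hB, h₂.congr ho hM hB hval (fun _ _ => Iff.rfl),
    ⟨i, hi, h₃, (hM i hi).1 h₄⟩, fun hlt htab => h₅ (hlt.congr (sw hM') (sw hM))
      (htab.congr ho (sw hM') (fun u hu => sw (hB u hu)) (fun u hu => sw (hval' u hu))
        (fun _ _ => Iff.rfl))⟩

/-- With `q ≥ 2` one has `r = q² + 1`, `t = q³`, `l = q⁴`, `Q = l ^ K` and `W = Q² n`. Thus counting
applies as `r < t`, a table, an index and the marker bit fit into a query as `t + r < l`, and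
matrices of width `W` hold all the objects. -/
theorem ParamRel.bounds {K n q r t l Q o O W : ℕ} (hK : 1 ≤ K) (hn : 2 ≤ n)
    (h : ParamRel K n q r t l Q o O W) :
    n ≤ q ∧ q < r ∧ r < t ∧ t + r < l ∧ l ≤ Q ∧ Q * Q + 1 ≤ W ∧ o < q ∧ O < Q := by
  obtain ⟨hq, hr, ht, hl, hQ, ho, hO, hW⟩ := h
  have hnq : n ≤ q := hq ▸ Nat.le_self_pow (by omega) n
  have ht' : t = q * q * q := by rw [← ht, ← hq]; ring
  have hl' : l = q * q * q * q := by rw [← hl, ← hq]; ring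
  have hQ' : Q = l ^ K := by rw [← hQ, ← hl, ← pow_mul]
  have hlQ : l ≤ Q := hQ' ▸ Nat.le_self_pow (by omega) l
  have hW' : W = Q * Q * n := by rw [← hW, ← hQ]; ring
  have h1 : 2 * (q * q) ≤ q * q * q := by
    rw [mul_comm 2]; exact Nat.mul_le_mul_left _ (by omega)
  have h2 : 2 * (q * q * q) ≤ q * q * q * q := by
    rw [mul_comm 2]; exact Nat.mul_le_mul_left _ (by omega)
  have h3 : 2 * (Q * Q) ≤ Q * Q * n := by
    rw [mul_comm 2]; exact Nat.mul_le_mul_left _ hn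
  have h4 : 2 * q ≤ q * q := Nat.mul_le_mul_right _ (by omega)
  have h5 : 0 < Q * Q := Nat.mul_pos (by omega) (by omega)
  refine ⟨hnq, ?_, ?_, ?_, hlQ, ?_, by omega, by omega⟩ <;> omega

/-! ### Membership in the hard language -/

section

variable {K n q r t l Q o O W : ℕ}

theorem ParamRel.eq {q' r' t' l' Q' o' O' W' : ℕ} (h : ParamRel K n q r t l Q o O W)
    (h' : ParamRel K n q' r' t' l' Q' o' O' W') :
    q' = q ∧ r' = r ∧ t' = t ∧ l' = l ∧ Q' = Q ∧ o' = o ∧ O' = O ∧ W' = W := by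
  obtain ⟨rfl, rfl, rfl, rfl, rfl, ho, hO, rfl⟩ := h
  obtain ⟨rfl, rfl, rfl, rfl, rfl, ho', hO', rfl⟩ := h'
  exact ⟨rfl, rfl, rfl, rfl, rfl, by omega, by omega, rfl⟩

theorem mem_hardLanguage_of_not_bit (hK : 1 ≤ K) (hn : 2 ≤ n) (hp : ParamRel K n q r t l Q o O W)
    (x : List Bool) (hx : x.length = n) (hbit : ¬ bitAt x (n - 1)) :
    x ∈ HardLanguage K ↔ ∃ T D B, ∀ M val T' val',
      HardFormula n q r t l Q o O (bitAt x) T D B M val T' val' := by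
  obtain ⟨b₁, b₂, b₃, b₄, b₅, b₆, b₇, b₈⟩ := hp.bounds hK hn
  have hWQ : Q ≤ W := (Nat.le_mul_self Q).trans (by omega)
  have hr : q * q + 1 = r := hp.2.1
  have hW : n ^ (8 * K * K + 1) = W := hp.2.2.2.2.2.2.2
  have hlen : 4 * W * W = 4 * x.length ^ (2 * (8 * K * K + 1)) := by
    rw [hx, ← hW, mul_assoc, ← pow_add, two_mul]
  constructor
  · rintro ⟨y, _, hy⟩
    refine ⟨matrixBit (bitAt y) W 0 0, matrixBit (bitAt y) W 1 0, matrixBit (bitAt y) W 2,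
      fun M val T' val' => ?_⟩
    -- The given instance of the universal quantifiers is packed into one string `z` of the maximal
    -- admissible length.
    obtain ⟨z, hz, hz'⟩ := exists_string_matrixBit W fun a i j =>
      (a = 0 ∧ M j) ∨ (a = 1 ∧ val i j) ∨ (a = 2 ∧ T' j) ∨ (a = 3 ∧ val' i j)
    have h := hy z (by omega)
    rw [hardPredicate_encodeTriple] at h
    obtain ⟨e, _, n', _, q', _, r', _, t', _, l', _, Q', _, o', _, O', _, W', _, he, hp', h⟩ := h
    obtain rfl : e = n - 1 := by omega
    rcases h with ⟨_, hn', h⟩ | ⟨h, _⟩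
    · obtain rfl : n' = n := by omega
      obtain ⟨rfl, rfl, rfl, rfl, rfl, rfl, rfl, rfl⟩ := hp.eq hp'
      refine h.congr hr (by omega) b₇ b₈ (fun _ _ => Iff.rfl) (fun _ _ => Iff.rfl)
        (fun _ _ _ _ => Iff.rfl) (fun i hi => ?_) (fun u hu g hg => ?_) (fun u hu => ?_)
        (fun i hi g hg => ?_)
      · rw [hz' 0 (by omega) 0 (by omega) i (by omega)]; simp
      · rw [hz' 1 (by omega) u (by omega) g (by omega)]; simp
      · rw [hz' 2 (by omega) 0 (by omega) u (by omega)]; simp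
      · rw [hz' 3 (by omega) i (by omega) g (by omega)]; simp
    · exact absurd h hbit
  · rintro ⟨T, D, B, h⟩
    obtain ⟨y, hy, hy'⟩ := exists_string_matrixBit W fun a i j =>
      (a = 0 ∧ T j) ∨ (a = 1 ∧ D j) ∨ (a = 2 ∧ B i j)
    refine ⟨y, by omega, fun z hz => ?_⟩
    rw [hardPredicate_encodeTriple]
    -- The bound on the parameters is the length of the encoded triple; `y` is long enough to make
    -- them admissible even when `z` is empty.
    have hyW : W ≤ y.length := by
      rw [hy, mul_assoc]
      exact (Nat.le_mul_self W).trans (Nat.le_mul_of_pos_left _ (by norm_num))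
    refine ⟨n - 1, by omega, n, by omega, q, by omega, r, by omega, t, by omega, l, by omega,
      Q, by omega, o, by omega, O, by omega, W, by omega, by omega, hp, Or.inl ⟨hbit, hx.symm, ?_⟩⟩
    refine (h (matrixBit (bitAt z) W 0 0) (matrixBit (bitAt z) W 1) (matrixBit (bitAt z) W 2 0)
      (matrixBit (bitAt z) W 3)).congr hr (by omega) b₇ b₈ (fun u hu => ?_) (fun i hi => ?_)
        (fun u hu g hg => ?_) (fun _ _ => Iff.rfl) (fun _ _ _ _ => Iff.rfl) (fun _ _ => Iff.rfl)
        (fun _ _ _ _ => Iff.rfl)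
    · rw [hy' 0 (by omega) 0 (by omega) u (by omega)]; simp
    · rw [hy' 1 (by omega) 0 (by omega) i (by omega)]; simp
    · rw [hy' 2 (by omega) u (by omega) g (by omega)]; simp

theorem mem_hardLanguage_of_bit (hK : 1 ≤ K) (hn : 2 ≤ n) (hp : ParamRel K n q r t l Q o O W)
    (x : List Bool) (hx : x.length = l) (hbit : bitAt x (l - 1)) :
    x ∈ HardLanguage K ↔ ∃ M val B, ∀ M' val',
      FirstCircuitFormula n q r t o (bitAt x) M val B M' val' := by
  obtain ⟨b₁, b₂, b₃, b₄, b₅, b₆, b₇, b₈⟩ := hp.bounds hK hn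
  have hWQ : Q ≤ W := (Nat.le_mul_self Q).trans (by omega)
  have hr : q * q + 1 = r := hp.2.1
  have hl : n ^ (4 * K) = l := hp.2.2.2.1
  have hW : n ^ (8 * K * K + 1) = W := hp.2.2.2.2.2.2.2
  have hlen : 4 * W * W ≤ 4 * x.length ^ (2 * (8 * K * K + 1)) := by
    rw [hx, ← hW, mul_assoc, ← pow_add, two_mul]
    exact Nat.mul_le_mul_left _ (Nat.pow_le_pow_left (by omega) _)
  constructor
  · rintro ⟨y, _, hy⟩
    refine ⟨matrixBit (bitAt y) W 0 0, matrixBit (bitAt y) W 1, matrixBit (bitAt y) W 2,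
      fun M' val' => ?_⟩
    obtain ⟨z, hz, hz'⟩ := exists_string_matrixBit W fun a i j =>
      (a = 0 ∧ M' j) ∨ (a = 1 ∧ val' i j)
    have h := hy z (by omega)
    rw [hardPredicate_encodeTriple] at h
    obtain ⟨e, _, n', _, q', _, r', _, t', _, l', _, Q', _, o', _, O', _, W', _, he, hp', h⟩ := h
    obtain rfl : e = l - 1 := by omega
    rcases h with ⟨h, _⟩ | ⟨_, hl', h⟩
    · exact absurd hbit h
    -- A query determines `n` from its length `l = n ^ (4 * K)`, since powers with a nonzero
    -- exponent are injective.
    · obtain rfl : n' = n := by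
        have h₁ := hp'.2.2.2.1
        rw [hl', hx, ← hl] at h₁
        exact Nat.pow_left_injective (by omega : 4 * K ≠ 0) h₁
      obtain ⟨rfl, rfl, rfl, rfl, rfl, rfl, rfl, rfl⟩ := hp.eq hp'
      refine h.congr hr (by omega) b₇ (fun _ _ => Iff.rfl) (fun _ _ _ _ => Iff.rfl)
        (fun _ _ _ _ => Iff.rfl) (fun i hi => ?_) (fun u hu g hg => ?_)
      · rw [hz' 0 (by omega) 0 (by omega) i (by omega)]; simp
      · rw [hz' 1 (by omega) u (by omega) g (by omega)]; simp
  · rintro ⟨M, val, B, h⟩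
    obtain ⟨y, hy, hy'⟩ := exists_string_matrixBit W fun a i j =>
      (a = 0 ∧ M j) ∨ (a = 1 ∧ val i j) ∨ (a = 2 ∧ B i j)
    refine ⟨y, by omega, fun z hz => ?_⟩
    rw [hardPredicate_encodeTriple]
    have hyW : W ≤ y.length := by
      rw [hy, mul_assoc]
      exact (Nat.le_mul_self W).trans (Nat.le_mul_of_pos_left _ (by norm_num))
    refine ⟨l - 1, by omega, n, by omega, q, by omega, r, by omega, t, by omega, l, by omega,
      Q, by omega, o, by omega, O, by omega, W, by omega, by omega, hp, Or.inr ⟨hbit, hx.symm, ?_⟩⟩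
    refine (h (matrixBit (bitAt z) W 0 0) (matrixBit (bitAt z) W 1)).congr hr (by omega) b₇
      (fun u hu => ?_) (fun u hu g hg => ?_) (fun u hu g hg => ?_) (fun _ _ => Iff.rfl)
      (fun _ _ _ _ => Iff.rfl)
    · rw [hy' 0 (by omega) 0 (by omega) u (by omega)]; simp
    · rw [hy' 1 (by omega) u (by omega) g (by omega)]; simp
    · rw [hy' 2 (by omega) u (by omega) g (by omega)]; simp

end

/-! ### The lower bound -/

open Classical in
theorem exists_string_of_bits (m : ℕ) (P : ℕ → Prop) :
    ∃ x : Fin m → Bool, (∀ i : Fin m, (P i ↔ x i = true)) ∧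
      ∀ i < m, (bitAt (List.ofFn x) i ↔ P i) := by
  refine ⟨fun i => decide (P i), fun i => by simp, fun i hi => ?_⟩
  simp [bitAt, hi]

section

variable {K n q r t l Q o O W : ℕ}

theorem HasTable.of_transcript {M M' : ℕ → Prop} {B val val' : ℕ → ℕ → Prop} {T : ℕ → Prop}
    (ho : o < q) (hM : ∀ i < q * q + 1, (M i ↔ M' i))
    (hval : ∀ u < t, IsTranscript M' q n (B u) (val' u)) (h : HasTable M q n t o B val T) :
    HasTable M' q n t o B val' T :=
  h.congr ho hM (fun _ _ _ _ => Iff.rfl)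
    (fun u hu => (h.1 u hu).unique hM (fun _ _ => Iff.rfl) (hval u hu)) fun _ _ => Iff.rfl

/-- The strings asking for the bits of the first circuit with an easy table. -/
theorem query_mem_hardLanguage_iff (hK : 1 ≤ K) (hn : 2 ≤ n)
    (hp : ParamRel K n q r t l Q o O W) {T M₀ : ℕ → Prop} {val₀ : ℕ → ℕ → Prop}
    (h₀ : HasTable M₀ q n t o (fun u g => u.testBit g = true) val₀ T)
    (hmin : ∀ M, LexLT r M M₀ → ¬ ∃ val, HasTable M q n t o (fun u g => u.testBit g = true) val T)
    {i : ℕ} (hi : i < r) (x : List Bool) (hx : x.length = l)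
    (hxb : ∀ g < l, (bitAt x g ↔ queryBit t l T i g)) : x ∈ HardLanguage K ↔ M₀ i := by
  obtain ⟨b₁, b₂, b₃, b₄, b₅, b₆, b₇, b₈⟩ := hp.bounds hK hn
  have hr : q * q + 1 = r := hp.2.1
  have hxT : ∀ u < t, (bitAt x u ↔ T u) := by
    intro u hu
    rw [hxb u (by omega), queryBit]
    constructor
    · rintro (h | h | h)
      · exact h.2
      · omega
      · omega
    · exact fun h => Or.inl ⟨hu, h⟩
  have hxi : ∀ j < r, (bitAt x (t + j) ↔ j = i) := by
    intro j hj
    rw [hxb _ (by omega), queryBit]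
    constructor
    · rintro (h | h | h) <;> omega
    · rintro rfl
      exact Or.inr (Or.inl rfl)
  have hbit : bitAt x (l - 1) := by
    rw [hxb _ (by omega), queryBit]
    exact Or.inr (Or.inr (by omega))
  rw [mem_hardLanguage_of_bit hK hn hp x hx hbit]
  constructor
  · rintro ⟨M, val, B, h⟩
    -- These parts of the formula do not involve the universally quantified circuit, so any instance
    -- yields them.
    obtain ⟨hB, hT, ⟨j, hj, hxj, hMj⟩, -⟩ := h (fun _ => False) fun _ _ => False
    obtain rfl := (hxi j hj).1 hxj
    have hBt := hB.iff_testBit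
    have hT' : HasTable M q n t o (fun u g => u.testBit g = true) val T :=
      hT.congr b₇ (fun _ _ => Iff.rfl) hBt (fun _ _ _ _ => Iff.rfl) hxT
    have hle : ¬ LexLT r M₀ M := fun hlt => (h M₀ val₀).2.2.2 hlt <|
      h₀.congr b₇ (fun _ _ => Iff.rfl) (fun u hu g hg => (hBt u hu g hg).symm)
        (fun _ _ _ _ => Iff.rfl) fun u hu => (hxT u hu).symm
    -- Both `M` and `M₀` are minimal circuits for the table, so their first `r` bits agree.
    exact (LexLT.trichotomy (fun hlt => hmin M hlt ⟨val, hT'⟩) hle _ hj).1 hMj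
  · intro hM
    refine ⟨M₀, val₀, fun u g => u.testBit g = true, fun M' val' => ⟨isBinaryTable_testBit t n,
      h₀.congr b₇ (fun _ _ => Iff.rfl) (fun _ _ _ _ => Iff.rfl) (fun _ _ _ _ => Iff.rfl)
        fun u hu => (hxT u hu).symm, ⟨i, hi, (hxi i hi).2 rfl, hM⟩, fun hlt h => hmin M' hlt
      ⟨val', h.congr b₇ (fun _ _ => Iff.rfl) (fun _ _ _ _ => Iff.rfl) (fun _ _ _ _ => Iff.rfl)
        hxT⟩⟩⟩

theorem eq_of_testBit_eq_of_lt {u v : ℕ} (hu : u < 2 ^ n) (hv : v < 2 ^ n)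
    (h : ∀ g < n, (u.testBit g = true ↔ v.testBit g = true)) : u = v := by
  refine Nat.eq_of_testBit_eq fun g => ?_
  rcases lt_or_ge g n with hg | hg
  · exact Bool.eq_iff_iff.2 (h g hg)
  · rw [Nat.testBit_lt_two_pow (hu.trans_le (Nat.pow_le_pow_right (by norm_num) hg)),
      Nat.testBit_lt_two_pow (hv.trans_le (Nat.pow_le_pow_right (by norm_num) hg))]

/-- The strings of length `n`, when `D` finds circuits for the easy tables. -/
theorem row_mem_hardLanguage_iff (hK : 1 ≤ K) (hn : 2 ≤ n)
    (hp : ParamRel K n q r t l Q o O W) (htn : t ≤ 2 ^ (n - 1)) {T₀ D : ℕ → Prop}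
    (hT₀ : ¬ ∃ M val, HasTable M q n t o (fun u g => u.testBit g = true) val T₀)
    (hmin : ∀ T, LexLT t T T₀ →
      ∃ M val, HasTable M q n t o (fun u g => u.testBit g = true) val T)
    (hD : ∀ T, (∃ M val, HasTable M q n t o (fun u g => u.testBit g = true) val T) →
      ∃ M₀ val₀, HasTable M₀ q n t o (fun u g => u.testBit g = true) val₀ T ∧
        ∀ i < r, ∀ val, IsTranscript D Q l (queryBit t l T i) val → (val O ↔ M₀ i))
    {u : ℕ} (hu : u < t) (x : List Bool) (hx : x.length = n)
    (hxb : ∀ g < n, (bitAt x g ↔ u.testBit g = true)) : x ∈ HardLanguage K ↔ T₀ u := by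
  obtain ⟨b₁, b₂, b₃, b₄, b₅, b₆, b₇, b₈⟩ := hp.bounds hK hn
  have hr : q * q + 1 = r := hp.2.1
  have hpow : 2 ^ (n - 1) ≤ 2 ^ n := Nat.pow_le_pow_right (by norm_num) (by omega)
  -- Rows below `t ≤ 2 ^ (n - 1)` have top digit zero, so they are never taken for queries.
  have hbit : ¬ bitAt x (n - 1) := by
    rw [hxb _ (by omega), Nat.testBit_lt_two_pow (by omega)]
    simp
  rw [mem_hardLanguage_of_not_bit hK hn hp x hx hbit]
  constructor
  · rintro ⟨T, D', B, h⟩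
    have hBt := (h T (fun _ => T) T fun _ => T).1.iff_testBit
    obtain ⟨v, hv, hTv, hxv⟩ := (h T (fun _ => T) T fun _ => T).2.1
    obtain rfl : v = u := eq_of_testBit_eq_of_lt (n := n) (by omega) (by omega) fun g hg => by
      rw [← hxb g hg, hxv g hg, hBt v hv g hg]
    have hBiff : ∀ {M val T}, HasTable M q n t o B val T ↔
        HasTable M q n t o (fun u g => u.testBit g = true) val T := fun {M val T} =>
      ⟨fun h => h.congr b₇ (fun _ _ => Iff.rfl) hBt (fun _ _ _ _ => Iff.rfl) fun _ _ => Iff.rfl,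
        fun h => h.congr b₇ (fun _ _ => Iff.rfl) (fun u hu g hg => (hBt u hu g hg).symm)
          (fun _ _ _ _ => Iff.rfl) fun _ _ => Iff.rfl⟩
    have hhard : ¬ ∃ M val, HasTable M q n t o (fun u g => u.testBit g = true) val T := by
      rintro ⟨M, val, hM⟩
      exact (h M val T val).2.2.1 (hBiff.2 hM)
    -- The guessed table has no circuit, hence is not below `T₀`. If `T₀` were below it, the answers
    -- of `D'`, correct or not, would assemble to a circuit for `T₀`.
    refine (LexLT.trichotomy (fun hlt => hhard (hmin T hlt)) (fun hlt => hT₀ ?_) v hv).1 hTv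
    let val' : ℕ → ℕ → Prop := fun i => circuitValue D' Q l (queryBit t l T₀ i)
    let M : ℕ → Prop := fun i => val' i O
    exact ⟨M, fun u => circuitValue M q n (B u), hBiff.1 <|
      (h M (fun u => circuitValue M q n (B u)) T₀ val').2.2.2 hlt
        (fun u _ => isTranscript_circuitValue _ _ _ _)
        fun i _ => ⟨isTranscript_circuitValue _ _ _ _, Iff.rfl⟩⟩
  · intro hTu
    refine ⟨T₀, D, fun u g => u.testBit g = true, fun M val T' val' =>
      ⟨isBinaryTable_testBit t n, ⟨u, hu, hTu, hxb⟩, fun h => hT₀ ⟨M, val, h⟩,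
        fun hlt hval hquery => ?_⟩⟩
    -- For this `D` the assembled circuit `M` agrees on its `r` bits with a circuit `M₀` for `T'`.
    obtain ⟨M₀, val₀, h₀, hM₀⟩ := hD T' (hmin T' hlt)
    refine h₀.of_transcript b₇ (fun i hi => ?_) hval
    rw [(hquery i (by omega)).2, hM₀ i (by omega) _ (hquery i (by omega)).1]

/-- The hard language has no small circuits at two related lengths. -/
theorem not_decides_hardLanguage (hK : 1 ≤ K) (hn : 2 ≤ n)
    (hp : ParamRel K n q r t l Q o O W) (htn : t ≤ 2 ^ (n - 1))
    (C : BoolCircuit n) (C' : BoolCircuit l) (hC : n + C.size < q) (hC' : l + C'.size < Q)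
    (h : ∀ x, C.eval x = true ↔ List.ofFn x ∈ HardLanguage K)
    (h' : ∀ x, C'.eval x = true ↔ List.ofFn x ∈ HardLanguage K) : False := by
  obtain ⟨b₁, b₂, b₃, b₄, b₅, b₆, b₇, b₈⟩ := hp.bounds hK hn
  have hr : q * q + 1 = r := hp.2.1
  have ho : o + 1 = q := hp.2.2.2.2.2.1
  have hO : O + 1 = Q := hp.2.2.2.2.2.2.1
  obtain ⟨T₀, hT₀, hmin⟩ := exists_lexLT_minimal t
    (exists_table_without_circuit q n t o b₇ (by omega) fun u g => u.testBit g = true)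
  obtain ⟨D, hD⟩ := C'.exists_bits hC'
  obtain ⟨M, hM⟩ := C.exists_bits hC
  -- The translated circuit `C` would have `T₀` as its table.
  refine hT₀ ⟨M, fun u => circuitValue M q n fun g => u.testBit g = true,
    fun u _ => isTranscript_circuitValue _ _ _ _, fun u hu => ?_⟩
  obtain ⟨x, hx, hxb⟩ := exists_string_of_bits n fun g => u.testBit g = true
  refine ((hM x _ _ o ho hx (isTranscript_circuitValue _ _ _ _)).trans (h x)).trans ?_
  refine row_mem_hardLanguage_iff hK hn hp htn hT₀ (fun T hT => not_not.1 (hmin T hT))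
    (D := D) (fun T hT => ?_) hu _ (List.length_ofFn) hxb
  obtain ⟨M₀, ⟨val₀, h₀⟩, hmin₀⟩ := exists_lexLT_minimal r hT
  refine ⟨M₀, val₀, h₀, fun i hi val hval => ?_⟩
  obtain ⟨y, hy, hyb⟩ := exists_string_of_bits l (queryBit t l T i)
  rw [hD y _ _ O hO hy hval, h']
  exact query_mem_hardLanguage_iff hK hn hp h₀ hmin₀ hi _ (List.length_ofFn) hyb

end

/-! ### Robustly-often simulations -/

/-- One extra factor `m` pays for the input wires; another one pays for the constant in `O(n ^ k)`,
see `eventually_size_le`. This explains `K = k + 2`. -/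
theorem add_lt_pow_of_le {k m s : ℕ} (hm : 3 ≤ m) (hs : s ≤ m ^ (k + 1)) :
    m + s < m ^ (k + 2) := by
  have h₁ : m ≤ m ^ (k + 1) := Nat.le_self_pow (by omega) m
  have h₂ : m ^ (k + 1) * 3 ≤ m ^ (k + 1) * m := Nat.mul_le_mul_left _ hm
  have h₃ : m ^ (k + 2) = m ^ (k + 1) * m := pow_succ _ _
  omega

theorem eventually_size_le {k : ℕ} {s : ℕ → ℕ}
    (h : (fun n => (s n : ℝ)) =O[Filter.atTop] fun n => ((n ^ k : ℕ) : ℝ)) :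
    ∀ᶠ n in Filter.atTop, s n ≤ n ^ (k + 1) := by
  obtain ⟨c, hc⟩ := h.bound
  filter_upwards [hc, Filter.eventually_ge_atTop ⌈c⌉₊] with n hn hcn
  rw [Real.norm_natCast, Real.norm_natCast] at hn
  have hcn' : c ≤ n := Nat.ceil_le.1 hcn
  have : (s n : ℝ) ≤ ((n ^ (k + 1) : ℕ) : ℝ) := by
    refine hn.trans ?_
    rw [pow_succ', Nat.cast_mul]
    exact mul_le_mul_of_nonneg_right hcn' (Nat.cast_nonneg _)
  exact_mod_cast this

theorem eventually_pow_le_two_pow (a : ℕ) : ∀ᶠ n : ℕ in Filter.atTop, n ^ a ≤ 2 ^ (n - 1) := by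
  have h := (isLittleO_pow_const_const_pow_of_one_lt (R := ℝ) a (r := 2) (by norm_num)).bound
    (c := 1 / 2) (by norm_num)
  filter_upwards [h, Filter.eventually_ge_atTop 1] with n hn h1
  obtain ⟨m, rfl⟩ : ∃ m, n = m + 1 := ⟨n - 1, by omega⟩
  rw [Real.norm_of_nonneg (by positivity), Real.norm_of_nonneg (by positivity), pow_succ 2] at hn
  have : (((m + 1 : ℕ) : ℝ)) ^ a ≤ 2 ^ m := by linarith
  rw [Nat.add_sub_cancel]
  exact_mod_cast this

theorem hardLanguage_notMem_robustlyOften (k : ℕ) :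
    HardLanguage (k + 2) ∉ RobustlyOften (SIZE fun n => n ^ k) := by
  rintro ⟨S, ⟨_, hS⟩, L, ⟨C, hC, hsize⟩, hL⟩
  obtain ⟨N, hN⟩ := Filter.eventually_atTop.1
    ((eventually_size_le hsize).and (eventually_pow_le_two_pow (3 * (k + 2))))
  -- Robustness gives no lower bound on `m` beyond `2`. Therefore `n = m ^ (N + 3)` is used, which
  -- exceeds the threshold `N`, and the exponent is chosen so that `n ^ (4 * (k + 2))` is exactly
  -- the right end of the interval.
  obtain ⟨m, hm, hmS⟩ := hS (4 * (k + 2) * (N + 3)) (by positivity)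
  obtain ⟨n, hnm⟩ : ∃ n, n = m ^ (N + 3) := ⟨_, rfl⟩
  have hNn : N + 3 < n := hnm ▸ Nat.lt_pow_self (by omega)
  have hnl : n ≤ n ^ (4 * (k + 2)) := Nat.le_self_pow (by omega) n
  have hl : n ^ (4 * (k + 2)) = m ^ (4 * (k + 2) * (N + 3)) := by
    rw [hnm, ← pow_mul, mul_comm]
  have hmn : m ≤ n := hnm ▸ Nat.le_self_pow (by omega) m
  have hdec : ∀ a, n ≤ a → a ≤ n ^ (4 * (k + 2)) → ∀ x : Fin a → Bool,
      (C a).eval x = true ↔ List.ofFn x ∈ HardLanguage (k + 2) := fun a h₁ h₂ x =>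
    (hC a x).trans (hL a (hmS a (by omega) (hl ▸ h₂)) _ List.length_ofFn).symm
  have hlt : ∀ a, n ≤ a → a + (C a).size < a ^ (k + 2) := fun a ha =>
    add_lt_pow_of_le (by omega) (hN a (by omega)).1
  have hq : 0 < n ^ (k + 2) := pow_pos (by omega) _
  have hQ : 0 < n ^ (4 * (k + 2) * (k + 2)) := pow_pos (by omega) _
  refine not_decides_hardLanguage (K := k + 2) (n := n) (by omega) (by omega)
    ⟨rfl, rfl, rfl, rfl, rfl, Nat.sub_add_cancel hq, Nat.sub_add_cancel hQ, rfl⟩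
    (hN n (by omega)).2 (C n) (C _) (hlt n le_rfl) ?_ (hdec n le_rfl hnl) (hdec _ hnl le_rfl)
  rw [pow_mul n (4 * (k + 2))]
  exact hlt _ hnl

theorem mainTheorem5 (k : ℕ) (hk : 1 < k) :
    ¬ (SigmaTwoP ⊆ RobustlyOften (SIZE (fun n => n ^ k))) := fun h =>
  hardLanguage_notMem_robustlyOften k (h (hardLanguage_mem_sigmaTwoP (k + 2)))
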